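/- Let $\Bbbk$ be a commutative ring in which $2$ is invertible; all modules and (super)algebras are over $\Bbbk$. A Lie superalgebra is a $\mathbb{Z}/2$-graded $\Bbbk$-module with an even bilinear bracket satisfying $[x,y]=-(-1)^{|x||y|}[y,x]$ and $[x,[y,z]]=[[x,y],z]+(-1)^{|x||y|}[y,[x,z]]$ for homogeneous elements; homomorphisms are even. For a unital associative superalgebra $R$ put $\rho(a)=(-1)^{|a|}a$ for homogeneous $a$. A superinvolution on $R$ is an even $\Bbbk$-linear map $a\mapsto\bar a$ with $\bar{\bar a}=a$ and $\overline{ab}=(-1)^{|a||b|}\bar b\,\bar a$ for homogeneous $a,b$. For $m\ge 3$, the Steinberg periplectic Lie superalgebra $\mathfrak{stp}_m(R,{}^-)$ is the Lie superalgebra generated by homogeneous elements $\mathbf t_{ij}(a),\mathbf f_{ij}(a),\mathbf g_{ij}(a)$ of parity $|a|,|a|+1,|a|+1$, for homogeneous $a\in R$ and $1\le i\ne j\le m$, subject to the following relations (with $\mathbf t_{ij},\mathbf f_{ij},\mathbf g_{ij}$ extended linearly to all of $R$): - $\mathbf t_{ij},\mathbf f_{ij},\mathbf g_{ij}$ are $\Bbbk$-linear;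 $\mathbf f_{ij}(\bar a)=\mathbf f_{ji}(\rho(a))$; $\mathbf g_{ij}(\bar a)=-\mathbf g_{ji}(\rho(a))$; - for distinct $i,j,k$: $[\mathbf t_{ij}(a),\mathbf t_{jk}(b)]=\mathbf t_{ik}(ab)$, $[\mathbf t_{ij}(a),\mathbf f_{jk}(b)]=\mathbf f_{ik}(ab)$, $[\mathbf g_{ij}(a),\mathbf t_{jk}(b)]=\mathbf g_{ik}(ab)$, $[\mathbf f_{ij}(a),\mathbf g_{jk}(b)]=\mathbf t_{ik}(ab)$; - for $i\ne j$ and $k\ne l$: $[\mathbf t_{ij}(a),\mathbf t_{kl}(b)]=0$ if $j\ne k$ and $l\ne i$; $[\mathbf t_{ij}(a),\mathbf f_{kl}(b)]=0$ if $j\ne k$ and $j\ne l$; $[\mathbf g_{ij}(a),\mathbf t_{kl}(b)]=0$ if $k\ne i$ and $k\ne j$; $[\mathbf f_{ij}(a),\mathbf f_{kl}(b)]=0$; $[\mathbf g_{ij}(a),\mathbf g_{kl}(b)]=0$; $[\mathbf f_{ij}(a),\mathbf g_{kl}(b)]=0$ if $i,j,k,l$ are distinct. For a unital associative superalgebra $S$,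 the Steinberg Lie superalgebra $\mathfrak{st}_{m|n}(S)$ is the Lie superalgebra generated by homogeneous elements $\mathbf e_{ij}(a)$ of parity $|i|+|j|+|a|$ for homogeneous $a\in S$ and $1\le i\ne j\le m+n$ (where $|i|=0$ for $i\le m$ and $|i|=1$ for $i>m$), extended linearly to all $a\in S$, subject to: $a\mapsto\mathbf e_{ij}(a)$ is $\Bbbk$-linear; $[\mathbf e_{ij}(a),\mathbf e_{jk}(b)]=\mathbf e_{ik}(ab)$ for distinct $i,j,k$; $[\mathbf e_{ij}(a),\mathbf e_{kl}(b)]=0$ for $i\ne j\ne k\ne l\ne i$. Let $S^{\mathrm{op}}$ be the opposite superalgebra of $S$, with product $a\cdot^{\mathrm{op}}b=(-1)^{|a||b|}ba$ for homogeneous $a,b$, and let $\mathrm{ex}(a\oplus b)=b\oplus a$, a superinvolution on $S\oplus S^{\mathrm{op}}$. **Proposition.** Let $S$ be any unital associative superalgebra over $\Bbbk$ and $m\ge 3$. Then $\mathfrak{stp}_m(S\oplus S^{\mathrm{op}},\mathrm{ex})\cong\mathfrak{st}_{m|m}(S)$ as Lie superalgebras over $\Bbbk$. More precisely, there are mutually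 inverse homomorphisms of Lie superalgebras $\phi:\mathfrak{st}_{m|m}(S)\to\mathfrak{stp}_m(S\oplus S^{\mathrm{op}},\mathrm{ex})$ and $\tilde\phi:\mathfrak{stp}_m(S\oplus S^{\mathrm{op}},\mathrm{ex})\to\mathfrak{st}_{m|m}(S)$ such that, for all $a,b\in S$ and $1\le i\ne j\le m$, $$\begin{aligned} \phi(\mathbf e_{ij}(a))&=\mathbf t_{ij}(a\oplus0), & \phi(\mathbf e_{i,m+j}(a))&=\mathbf f_{ij}(a\oplus0),\\ \phi(\mathbf e_{m+i,j}(a))&=\mathbf g_{ij}(a\oplus0), & \phi(\mathbf e_{m+i,m+j}(a))&=-\mathbf t_{ji}(0\oplus a),\\ \phi(\mathbf e_{i,m+i}(a))&=[\mathbf t_{ij}(1\oplus0),\mathbf f_{ji}(a\oplus0)], & \phi(\mathbf e_{m+i,i}(a))&=[\mathbf g_{ij}(a\oplus0),\mathbf t_{ji}(1\oplus0)], \end{aligned}$$ $$\begin{aligned} \tilde\phi(\mathbf t_{ij}(a\oplus b))&=\mathbf e_{ij}(a)-\mathbf e_{m+j,m+i}(b),\\ \tilde\phi(\mathbf f_{ij}(a\oplus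 b))&=\mathbf e_{i,m+j}(a)+\mathbf e_{j,m+i}(\rho(b)),\\ \tilde\phi(\mathbf g_{ij}(a\oplus b))&=\mathbf e_{m+i,j}(a)-\mathbf e_{m+j,i}(\rho(b)). \end{aligned}$$ -/

import Mathlib

open DirectSum

universe u v

noncomputable section

namespace Steinberg

/-! ### Gradings by `ZMod 2` -/

section Grading

variable {k : Type u} [CommRing k] {M : Type v} [AddCommGroup M] [Module k M]

/-- A `ZMod 2`-grading obtained from a complete family of projections. -/
@[reducible]
def decompositionOfProj (𝒜 : ZMod 2 → Submodule k M) (π : ZMod 2 → M →ₗ[k] M)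
    (hmem : ∀ p x, π p x ∈ 𝒜 p) (hsum : ∀ x, ∑ p, π p x = x)
    (hπ : ∀ p, ∀ x ∈ 𝒜 p, ∀ q, π q x = if p = q then x else 0) :
    DirectSum.Decomposition 𝒜 :=
  DirectSum.Decomposition.ofLinearMap 𝒜
    (∑ p, (DirectSum.lof k (ZMod 2) (fun p => 𝒜 p) p) ∘ₗ (π p).codRestrict (𝒜 p) (hmem p))
    (by
      ext x
      simp only [LinearMap.comp_apply, LinearMap.sum_apply, map_sum, LinearMap.id_apply]
      conv_rhs => rw [← hsum x]
      refine Finset.sum_congr rfl fun p _ => ?_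
      rw [DirectSum.coeLinearMap_lof]
      rfl)
    (by
      ext p x : 2
      simp only [LinearMap.comp_apply, LinearMap.sum_apply, LinearMap.id_apply,
        DirectSum.coeLinearMap_lof]
      rw [Finset.sum_eq_single p]
      · congr 1
        apply Subtype.ext
        simp [hπ p x x.2]
      · intro q _ hq
        have : (π q).codRestrict (𝒜 q) (hmem q) (x : M) = 0 := by
          apply Subtype.ext
          simp [hπ p x x.2, hq.symm]
        rw [this, map_zero]
      · simp)

variable (𝒜 : ZMod 2 → Submodule k M) [DirectSum.Decomposition 𝒜]

/-- The `p`-th homogeneous component of an element. -/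
def gproj (p : ZMod 2) : M →ₗ[k] M :=
  (𝒜 p).subtype ∘ₗ DirectSum.component k (ZMod 2) (fun p => 𝒜 p) p ∘ₗ
    (DirectSum.decomposeLinearEquiv 𝒜).toLinearMap

theorem gproj_apply (p : ZMod 2) (x : M) : gproj 𝒜 p x = (decompose 𝒜 x p : M) :=
  rfl

theorem gproj_mem (p : ZMod 2) (x : M) : gproj 𝒜 p x ∈ 𝒜 p :=
  (decompose 𝒜 x p).2

theorem sum_gproj (x : M) : ∑ p, gproj 𝒜 p x = x := by
  classical
  conv_rhs => rw [← DirectSum.sum_support_decompose 𝒜 x]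
  refine (Finset.sum_subset (Finset.subset_univ _) fun p _ hp => ?_).symm
  rw [DFinsupp.notMem_support_iff] at hp
  exact congrArg Subtype.val hp

theorem gproj_of_mem (p : ZMod 2) (x : M) (hx : x ∈ 𝒜 p) (q : ZMod 2) :
    gproj 𝒜 q x = if p = q then x else 0 := by
  split_ifs with h
  · subst h
    exact decompose_of_mem_same 𝒜 hx
  · exact decompose_of_mem_ne 𝒜 hx h

/-- The parity map `ρ` of a superspace: `ρ a = (-1)^{|a|} a` for homogeneous `a`. -/
def rho : M →ₗ[k] M :=
  ∑ p : ZMod 2, ((-1 : ℤˣ) ^ p) • gproj 𝒜 p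

variable {𝒜} in
theorem rho_of_mem {p : ZMod 2} {a : M} (ha : a ∈ 𝒜 p) : rho 𝒜 a = ((-1 : ℤˣ) ^ p) • a := by
  rw [rho, LinearMap.sum_apply, Finset.sum_eq_single p]
  · rw [LinearMap.smul_apply, gproj_of_mem 𝒜 p a ha, if_pos rfl]
  · intro q _ hq
    rw [LinearMap.smul_apply, gproj_of_mem 𝒜 p a ha, if_neg hq.symm, smul_zero]
  · simp

variable {𝒜} in
theorem rho_mem {p : ZMod 2} {a : M} (ha : a ∈ 𝒜 p) : rho 𝒜 a ∈ 𝒜 p := by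
  rw [rho_of_mem ha, Units.smul_def]
  exact zsmul_mem ha _

end Grading

/-! ### The opposite superalgebra and `S ⊕ S^op` -/

section Opposite

variable {k : Type u} [CommRing k] {S : Type v} [Ring S] [Algebra k S]

/-- The module underlying the opposite superalgebra of `S`. -/
def SuperOp (_𝒮 : ZMod 2 → Submodule k S) : Type v := S

variable (𝒮 : ZMod 2 → Submodule k S)

instance : AddCommGroup (SuperOp 𝒮) := inferInstanceAs (AddCommGroup S)

instance : Module k (SuperOp 𝒮) := inferInstanceAs (Module k S)

/-- The identity map `S → S^op`. -/
def toOp : S ≃ₗ[k] SuperOp 𝒮 := LinearEquiv.refl k S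

/-- The grading of `S^op`, the same as that of `S`. -/
def opGrading (p : ZMod 2) : Submodule k (SuperOp 𝒮) := (𝒮 p).map (toOp 𝒮).toLinearMap

variable {𝒮} in
theorem toOp_mem {p : ZMod 2} {a : S} (ha : a ∈ 𝒮 p) : toOp 𝒮 a ∈ opGrading 𝒮 p :=
  Submodule.mem_map_of_mem ha

variable {𝒮} in
theorem opGrading_cases {p : ZMod 2} {x : SuperOp 𝒮} (hx : x ∈ opGrading 𝒮 p) :
    ∃ a ∈ 𝒮 p, x = toOp 𝒮 a := by
  obtain ⟨a, ha, h⟩ := hx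
  exact ⟨a, ha, h.symm⟩

variable [GradedAlgebra 𝒮]

/-- The product of `S^op`: it is biadditive, and `a · b = (-1)^{|a||b|} b a` for homogeneous
`a` and `b`. -/
instance : Mul (SuperOp 𝒮) where
  mul a b := toOp 𝒮 (∑ p : ZMod 2, ∑ q : ZMod 2, ((-1 : ℤˣ) ^ (p * q)) •
    ((decompose 𝒮 ((toOp 𝒮).symm b) q : S) * (decompose 𝒮 ((toOp 𝒮).symm a) p : S)))

instance : One (SuperOp 𝒮) where
  one := toOp 𝒮 1

theorem toOp_mul_toOp (a b : S) : toOp 𝒮 a * toOp 𝒮 b =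
    toOp 𝒮 (∑ p : ZMod 2, ∑ q : ZMod 2,
      ((-1 : ℤˣ) ^ (p * q)) • ((decompose 𝒮 b q : S) * (decompose 𝒮 a p : S))) :=
  rfl

variable {𝒮} in
theorem toOp_mul_toOp_of_mem {a b : S} {p q : ZMod 2} (ha : a ∈ 𝒮 p) (hb : b ∈ 𝒮 q) :
    toOp 𝒮 a * toOp 𝒮 b = ((-1 : ℤˣ) ^ (p * q)) • toOp 𝒮 (b * a) := by
  rw [toOp_mul_toOp, Finset.sum_eq_single p, Finset.sum_eq_single q]
  · rw [decompose_of_mem_same 𝒮 ha, decompose_of_mem_same 𝒮 hb]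
    rfl
  · intro r _ hr
    rw [decompose_of_mem_ne 𝒮 hb hr.symm, zero_mul, smul_zero]
  · simp
  · intro r _ hr
    refine Finset.sum_eq_zero fun s _ => ?_
    rw [decompose_of_mem_ne 𝒮 ha hr.symm, mul_zero, smul_zero]
  · simp

variable {𝒮} in
theorem op_induction {motive : SuperOp 𝒮 → Prop} (zero : motive 0)
    (homogeneous : ∀ p, ∀ a ∈ 𝒮 p, motive (toOp 𝒮 a))
    (add : ∀ x y, motive x → motive y → motive (x + y)) (x : SuperOp 𝒮) : motive x := by
  have key : ∀ a : S, motive (toOp 𝒮 a) := fun a =>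
    DirectSum.Decomposition.inductionOn 𝒮 (motive := fun a => motive (toOp 𝒮 a))
      (by simpa using zero) (fun m => homogeneous _ _ m.2)
      (fun a b ha hb => by simpa using add _ _ ha hb) a
  exact key ((toOp 𝒮).symm x)

protected theorem op_add_mul (x y z : SuperOp 𝒮) : (x + y) * z = x * z + y * z := by
  obtain ⟨a, rfl⟩ := (toOp 𝒮).surjective x
  obtain ⟨b, rfl⟩ := (toOp 𝒮).surjective y
  obtain ⟨c, rfl⟩ := (toOp 𝒮).surjective z
  rw [← map_add, toOp_mul_toOp, toOp_mul_toOp, toOp_mul_toOp, ← map_add]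
  simp only [decompose_add, DirectSum.add_apply, Submodule.coe_add, mul_add, smul_add,
    Finset.sum_add_distrib]

protected theorem op_mul_add (x y z : SuperOp 𝒮) : x * (y + z) = x * y + x * z := by
  obtain ⟨a, rfl⟩ := (toOp 𝒮).surjective x
  obtain ⟨b, rfl⟩ := (toOp 𝒮).surjective y
  obtain ⟨c, rfl⟩ := (toOp 𝒮).surjective z
  rw [← map_add, toOp_mul_toOp, toOp_mul_toOp, toOp_mul_toOp, ← map_add]
  simp only [decompose_add, DirectSum.add_apply, Submodule.coe_add, add_mul, smul_add,
    Finset.sum_add_distrib]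

protected theorem op_zero_mul (x : SuperOp 𝒮) : 0 * x = 0 := by
  have h := Steinberg.op_add_mul 𝒮 0 0 x
  rw [add_zero] at h
  exact left_eq_add.mp h

protected theorem op_mul_zero (x : SuperOp 𝒮) : x * 0 = 0 := by
  have h := Steinberg.op_mul_add 𝒮 x 0 0
  rw [add_zero] at h
  exact left_eq_add.mp h

protected theorem op_smul_mul (r : k) (x y : SuperOp 𝒮) : (r • x) * y = r • (x * y) := by
  obtain ⟨a, rfl⟩ := (toOp 𝒮).surjective x
  obtain ⟨b, rfl⟩ := (toOp 𝒮).surjective y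
  rw [← map_smul, toOp_mul_toOp, toOp_mul_toOp, ← map_smul]
  simp only [decompose_smul, DirectSum.smul_apply, Submodule.coe_smul, mul_smul_comm, Finset.smul_sum,
    smul_comm r]

protected theorem op_mul_smul (r : k) (x y : SuperOp 𝒮) : x * (r • y) = r • (x * y) := by
  obtain ⟨a, rfl⟩ := (toOp 𝒮).surjective x
  obtain ⟨b, rfl⟩ := (toOp 𝒮).surjective y
  rw [← map_smul, toOp_mul_toOp, toOp_mul_toOp, ← map_smul]
  simp only [decompose_smul, DirectSum.smul_apply, Submodule.coe_smul, smul_mul_assoc, Finset.smul_sum,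
    smul_comm r]

protected theorem op_units_smul_mul (r : ℤˣ) (x y : SuperOp 𝒮) : (r • x) * y = r • (x * y) := by
  have h := Steinberg.op_smul_mul 𝒮 ((r : ℤ) : k) x y
  rwa [Int.cast_smul_eq_zsmul, Int.cast_smul_eq_zsmul] at h

protected theorem op_mul_units_smul (r : ℤˣ) (x y : SuperOp 𝒮) : x * (r • y) = r • (x * y) := by
  have h := Steinberg.op_mul_smul 𝒮 ((r : ℤ) : k) x y
  rwa [Int.cast_smul_eq_zsmul, Int.cast_smul_eq_zsmul] at h

protected theorem op_mul_assoc (x y z : SuperOp 𝒮) : x * y * z = x * (y * z) := by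
  induction x using op_induction with
  | zero => simp only [Steinberg.op_zero_mul]
  | add x x' hx hx' => simp only [Steinberg.op_add_mul, hx, hx']
  | homogeneous p a ha =>
    induction y using op_induction with
    | zero => simp only [Steinberg.op_zero_mul, Steinberg.op_mul_zero]
    | add y y' hy hy' => simp only [Steinberg.op_add_mul, Steinberg.op_mul_add, hy, hy']
    | homogeneous q b hb =>
      induction z using op_induction with
      | zero => simp only [Steinberg.op_mul_zero]
      | add z z' hz hz' => simp only [Steinberg.op_mul_add, hz, hz']
      | homogeneous r c hc =>
        rw [toOp_mul_toOp_of_mem ha hb, toOp_mul_toOp_of_mem hb hc,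
          Steinberg.op_units_smul_mul, Steinberg.op_mul_units_smul,
          toOp_mul_toOp_of_mem (SetLike.mul_mem_graded hb ha) hc,
          toOp_mul_toOp_of_mem ha (SetLike.mul_mem_graded hc hb), smul_smul, smul_smul,
          mul_assoc, ← uzpow_add, ← uzpow_add]
        congr 2
        ring

protected theorem op_one_mul (x : SuperOp 𝒮) : 1 * x = x := by
  induction x using op_induction with
  | zero => simp only [Steinberg.op_mul_zero]
  | add x x' hx hx' => simp only [Steinberg.op_mul_add, hx, hx']
  | homogeneous p a ha =>
    have h := toOp_mul_toOp_of_mem (SetLike.one_mem_graded 𝒮) ha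
    rwa [zero_mul, uzpow_zero, one_smul, mul_one] at h

protected theorem op_mul_one (x : SuperOp 𝒮) : x * 1 = x := by
  induction x using op_induction with
  | zero => simp only [Steinberg.op_zero_mul]
  | add x x' hx hx' => simp only [Steinberg.op_add_mul, hx, hx']
  | homogeneous p a ha =>
    have h := toOp_mul_toOp_of_mem ha (SetLike.one_mem_graded 𝒮)
    rwa [mul_zero, uzpow_zero, one_smul, one_mul] at h

instance : Ring (SuperOp 𝒮) where
  __ := (inferInstance : AddCommGroup (SuperOp 𝒮))
  mul := (· * ·)
  one := 1
  left_distrib := Steinberg.op_mul_add 𝒮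
  right_distrib := Steinberg.op_add_mul 𝒮
  zero_mul := Steinberg.op_zero_mul 𝒮
  mul_zero := Steinberg.op_mul_zero 𝒮
  mul_assoc := Steinberg.op_mul_assoc 𝒮
  one_mul := Steinberg.op_one_mul 𝒮
  mul_one := Steinberg.op_mul_one 𝒮

instance : Algebra k (SuperOp 𝒮) :=
  Algebra.ofModule (Steinberg.op_smul_mul 𝒮) (Steinberg.op_mul_smul 𝒮)

instance : SetLike.GradedMonoid (opGrading 𝒮) where
  one_mem := toOp_mem (SetLike.one_mem_graded 𝒮)
  mul_mem p q x y hx hy := by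
    obtain ⟨a, ha, ea⟩ := opGrading_cases hx
    obtain ⟨b, hb, eb⟩ := opGrading_cases hy
    rw [ea, eb, toOp_mul_toOp_of_mem ha hb, Units.smul_def]
    refine zsmul_mem (toOp_mem ?_) _
    rw [add_comm]
    exact SetLike.mul_mem_graded hb ha

instance : GradedAlgebra (opGrading 𝒮) where
  __ := decompositionOfProj (opGrading 𝒮)
    (fun p => (toOp 𝒮).toLinearMap ∘ₗ gproj 𝒮 p ∘ₗ (toOp 𝒮).symm.toLinearMap)
    (fun p x => toOp_mem (gproj_mem 𝒮 p _))
    (fun x => by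
      obtain ⟨a, rfl⟩ := (toOp 𝒮).surjective x
      simp only [LinearMap.comp_apply, LinearEquiv.coe_coe, LinearEquiv.symm_apply_apply,
        ← map_sum, sum_gproj])
    (fun p x hx q => by
      obtain ⟨a, ha, e⟩ := opGrading_cases hx
      rw [e]
      simp only [LinearMap.comp_apply, LinearEquiv.coe_coe, LinearEquiv.symm_apply_apply,
        gproj_of_mem 𝒮 p a ha q]
      split_ifs <;> simp)

end Opposite

section Prod

variable {k : Type u} [CommRing k] {A B : Type v} [Ring A] [Algebra k A] [Ring B] [Algebra k B]

/-- The grading of the direct sum `A ⊕ B` of two superalgebras. -/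
def prodGrading (𝒜 : ZMod 2 → Submodule k A) (ℬ : ZMod 2 → Submodule k B) (p : ZMod 2) :
    Submodule k (A × B) :=
  (𝒜 p).prod (ℬ p)

instance (𝒜 : ZMod 2 → Submodule k A) (ℬ : ZMod 2 → Submodule k B) [GradedAlgebra 𝒜]
    [GradedAlgebra ℬ] : GradedAlgebra (prodGrading 𝒜 ℬ) where
  one_mem := ⟨SetLike.one_mem_graded 𝒜, SetLike.one_mem_graded ℬ⟩
  mul_mem _ _ _ _ hx hy :=
    ⟨SetLike.mul_mem_graded hx.1 hy.1, SetLike.mul_mem_graded hx.2 hy.2⟩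
  __ := decompositionOfProj (prodGrading 𝒜 ℬ) (fun p => (gproj 𝒜 p).prodMap (gproj ℬ p))
    (fun p x => ⟨gproj_mem 𝒜 p _, gproj_mem ℬ p _⟩)
    (fun x => Prod.ext (by simp [Prod.fst_sum, sum_gproj]) (by simp [Prod.snd_sum, sum_gproj]))
    (fun p x hx q => by
      apply Prod.ext
      · rw [LinearMap.prodMap_apply, gproj_of_mem 𝒜 p _ hx.1]
        split_ifs <;> rfl
      · rw [LinearMap.prodMap_apply, gproj_of_mem ℬ p _ hx.2]
        split_ifs <;> rfl)

end Prod

/-! ### Superinvolutions -/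

section Superinvolution

variable {k : Type u} [CommRing k]

/-- A superinvolution of a superalgebra `R`: an even `k`-linear map of square the identity with
`bar (a b) = (-1)^{|a||b|} (bar b) (bar a)` for homogeneous `a` and `b`. -/
structure Superinvolution {R : Type v} [Ring R] [Algebra k R] (ℛ : ZMod 2 → Submodule k R) where
  bar : R →ₗ[k] R
  bar_mem : ∀ {p : ZMod 2} {a : R}, a ∈ ℛ p → bar a ∈ ℛ p
  bar_mul : ∀ {p q : ZMod 2} {a b : R}, a ∈ ℛ p → b ∈ ℛ q →
    bar (a * b) = ((-1 : ℤˣ) ^ (p * q)) • (bar b * bar a)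
  bar_bar : ∀ a : R, bar (bar a) = a

variable {S : Type v} [Ring S] [Algebra k S] (𝒮 : ZMod 2 → Submodule k S) [GradedAlgebra 𝒮]

/-- The exchange superinvolution `a ⊕ b ↦ b ⊕ a` of `S ⊕ S^op`. -/
def exchange : Superinvolution (prodGrading 𝒮 (opGrading 𝒮)) where
  bar :=
    { toFun := fun x => ((toOp 𝒮).symm x.2, toOp 𝒮 x.1)
      map_add' := fun x y => by simp
      map_smul' := fun r x => by simp }
  bar_mem := by
    intro p x hx
    obtain ⟨b, hb, e⟩ := opGrading_cases hx.2
    refine ⟨?_, toOp_mem hx.1⟩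
    change (toOp 𝒮).symm x.2 ∈ 𝒮 p
    rwa [e, LinearEquiv.symm_apply_apply]
  bar_mul := by
    intro p q x y hx hy
    obtain ⟨c, hc, ec⟩ := opGrading_cases hx.2
    obtain ⟨d, hd, ed⟩ := opGrading_cases hy.2
    apply Prod.ext
    · change (toOp 𝒮).symm (x.2 * y.2) =
        ((-1 : ℤˣ) ^ (p * q)) • ((toOp 𝒮).symm y.2 * (toOp 𝒮).symm x.2)
      rw [ec, ed, toOp_mul_toOp_of_mem hc hd]
      rfl
    · change toOp 𝒮 (x.1 * y.1) = ((-1 : ℤˣ) ^ (p * q)) • (toOp 𝒮 y.1 * toOp 𝒮 x.1)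
      rw [toOp_mul_toOp_of_mem hy.1 hx.1, smul_smul, mul_comm q p, ← mul_uzpow]
      simp
  bar_bar := fun x => by simp

end Superinvolution

/-! ### Lie superalgebras -/

/-- A Lie superalgebra over a commutative ring `k` in which `2` is invertible: a `ZMod 2`-graded
module with an even bilinear bracket that is super skew-symmetric and satisfies the super Jacobi
identity. -/
structure LieSuperalgebra (k : Type u) [CommRing k] where
  carrier : Type v
  [addCommGroup : AddCommGroup carrier]
  [module : Module k carrier]
  grading : ZMod 2 → Submodule k carrier
  isInternal : DirectSum.IsInternal grading
  bracket : carrier →ₗ[k] carrier →ₗ[k] carrier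
  bracket_mem : ∀ {p q : ZMod 2} {x y : carrier}, x ∈ grading p → y ∈ grading q →
    bracket x y ∈ grading (p + q)
  skew : ∀ {p q : ZMod 2} {x y : carrier}, x ∈ grading p → y ∈ grading q →
    bracket x y = -(((-1 : ℤˣ) ^ (p * q)) • bracket y x)
  jacobi : ∀ {p q : ZMod 2} {x y : carrier}, x ∈ grading p → y ∈ grading q → ∀ z : carrier,
    bracket x (bracket y z) =
      bracket (bracket x y) z + ((-1 : ℤˣ) ^ (p * q)) • bracket y (bracket x z)

attribute [instance] LieSuperalgebra.addCommGroup LieSuperalgebra.module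

namespace LieSuperalgebra

variable {k : Type u} [CommRing k]

/-- A homomorphism of Lie superalgebras: an even `k`-linear map compatible with the brackets. -/
structure Hom (L : LieSuperalgebra.{u, v} k) (L' : LieSuperalgebra.{u, v} k) where
  toLinearMap : L.carrier →ₗ[k] L'.carrier
  map_mem : ∀ {p : ZMod 2} {x : L.carrier}, x ∈ L.grading p → toLinearMap x ∈ L'.grading p
  map_bracket : ∀ x y : L.carrier,
    toLinearMap (L.bracket x y) = L'.bracket (toLinearMap x) (toLinearMap y)

instance (L L' : LieSuperalgebra.{u, v} k) : CoeFun (L.Hom L') fun _ => L.carrier → L'.carrier where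
  coe f := f.toLinearMap

end LieSuperalgebra

/-! ### Lie superalgebras given by homogeneous generators and relations -/

namespace Presentation

variable {k : Type u} [CommRing k] {X : Type v} (par : X → ZMod 2)

/-- The parity of a nonassociative monomial in generators of given parities. -/
def wordParity : FreeMagma X → ZMod 2
  | .of x => par x
  | .mul u w => wordParity u + wordParity w

variable (k) in
/-- The grading of the free nonassociative algebra. -/
def freeGrading (p : ZMod 2) : Submodule k (FreeNonUnitalNonAssocAlgebra k X) :=
  Submodule.span k {x | ∃ w : FreeMagma X, wordParity par w = p ∧ x = MonoidAlgebra.single w 1}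

/-- The relations that make an algebra a Lie superalgebra. -/
inductive LieRel : FreeNonUnitalNonAssocAlgebra k X → Prop
  | skew {p q : ZMod 2} {x y : FreeNonUnitalNonAssocAlgebra k X}
      (hx : x ∈ freeGrading k par p) (hy : y ∈ freeGrading k par q) :
      LieRel (x * y + ((-1 : ℤˣ) ^ (p * q)) • (y * x))
  | jacobi {p q r : ZMod 2} {x y z : FreeNonUnitalNonAssocAlgebra k X}
      (hx : x ∈ freeGrading k par p) (hy : y ∈ freeGrading k par q)
      (hz : z ∈ freeGrading k par r) :
      LieRel (x * (y * z) - x * y * z - ((-1 : ℤˣ) ^ (p * q)) • (y * (x * z)))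

/-- The two-sided ideal generated by the Lie superalgebra relations and by `rels`. -/
def relIdeal (rels : Set (FreeNonUnitalNonAssocAlgebra k X)) :
    Submodule k (FreeNonUnitalNonAssocAlgebra k X) :=
  sInf {I | (∀ z, LieRel par z → z ∈ I) ∧ rels ⊆ I ∧ ∀ x, ∀ y ∈ I, x * y ∈ I ∧ y * x ∈ I}

variable (rels : Set (FreeNonUnitalNonAssocAlgebra k X))

theorem relIdeal_of_lieRel {z : FreeNonUnitalNonAssocAlgebra k X} (hz : LieRel par z) :
    z ∈ relIdeal par rels := by
  rw [relIdeal, Submodule.mem_sInf]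
  exact fun I hI => hI.1 z hz

theorem relIdeal_of_rels {z : FreeNonUnitalNonAssocAlgebra k X} (hz : z ∈ rels) :
    z ∈ relIdeal par rels := by
  rw [relIdeal, Submodule.mem_sInf]
  exact fun I hI => hI.2.1 hz

theorem relIdeal_mul_mem (x : FreeNonUnitalNonAssocAlgebra k X)
    {y : FreeNonUnitalNonAssocAlgebra k X} (hy : y ∈ relIdeal par rels) :
    x * y ∈ relIdeal par rels ∧ y * x ∈ relIdeal par rels := by
  rw [relIdeal, Submodule.mem_sInf] at hy
  simp only [relIdeal, Submodule.mem_sInf]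
  exact ⟨fun I hI => (hI.2.2 x y (hy I hI)).1, fun I hI => (hI.2.2 x y (hy I hI)).2⟩

theorem relIdeal_le {I : Submodule k (FreeNonUnitalNonAssocAlgebra k X)}
    (h₁ : ∀ z, LieRel par z → z ∈ I) (h₂ : rels ⊆ I)
    (h₃ : ∀ x, ∀ y ∈ I, x * y ∈ I ∧ y * x ∈ I) : relIdeal par rels ≤ I :=
  sInf_le ⟨h₁, h₂, h₃⟩

variable (k) in
/-- The projection of the free nonassociative algebra onto a homogeneous component. -/
def freeProj (p : ZMod 2) :
    FreeNonUnitalNonAssocAlgebra k X →ₗ[k] FreeNonUnitalNonAssocAlgebra k X :=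
  (MonoidAlgebra.coeffLinearEquiv k).symm.toLinearMap ∘ₗ
    (Finsupp.lsum k fun w : FreeMagma X =>
      if wordParity par w = p then Finsupp.lsingle w else 0) ∘ₗ
    (MonoidAlgebra.coeffLinearEquiv k).toLinearMap

theorem freeProj_single (p : ZMod 2) (w : FreeMagma X) (r : k) :
    freeProj k par p (MonoidAlgebra.single w r) =
      if wordParity par w = p then MonoidAlgebra.single w r else 0 := by
  have h : freeProj k par p (MonoidAlgebra.single w r) =
      (MonoidAlgebra.coeffLinearEquiv k).symm
        ((Finsupp.lsum k fun w : FreeMagma X =>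
          if wordParity par w = p then (Finsupp.lsingle w : k →ₗ[k] _) else 0)
            (Finsupp.single w r)) := rfl
  rw [h, Finsupp.lsum_single]
  split_ifs
  · rfl
  · simp

theorem single_mem (w : FreeMagma X) (r : k) :
    MonoidAlgebra.single w r ∈ freeGrading k par (wordParity par w) := by
  have h : (MonoidAlgebra.single w r : FreeNonUnitalNonAssocAlgebra k X) =
      r • MonoidAlgebra.single w 1 := by
    rw [MonoidAlgebra.smul_single, smul_eq_mul, mul_one]
  rw [h]
  exact Submodule.smul_mem _ _ (Submodule.subset_span ⟨w, rfl, rfl⟩)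

theorem of_mem (x : X) : FreeNonUnitalNonAssocAlgebra.of k x ∈ freeGrading k par (par x) :=
  single_mem par (FreeMagma.of x) 1

theorem freeProj_mem (p : ZMod 2) (x : FreeNonUnitalNonAssocAlgebra k X) :
    freeProj k par p x ∈ freeGrading k par p := by
  induction x using MonoidAlgebra.induction_linear with
  | zero => simp
  | add x y hx hy =>
    rw [map_add]
    exact add_mem hx hy
  | single w r =>
    rw [freeProj_single]
    split_ifs with h
    · subst h
      exact single_mem par w r
    · exact zero_mem _

theorem sum_freeProj (x : FreeNonUnitalNonAssocAlgebra k X) : ∑ p, freeProj k par p x = x := by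
  induction x using MonoidAlgebra.induction_linear with
  | zero => simp
  | add x y hx hy => simp only [map_add, Finset.sum_add_distrib, hx, hy]
  | single w r => simp [freeProj_single]

theorem freeProj_of_mem (p : ZMod 2) (x : FreeNonUnitalNonAssocAlgebra k X)
    (hx : x ∈ freeGrading k par p) (q : ZMod 2) :
    freeProj k par q x = if p = q then x else 0 := by
  induction hx using Submodule.span_induction with
  | mem x hx =>
    obtain ⟨w, rfl, rfl⟩ := hx
    exact freeProj_single par q w 1
  | zero => simp
  | add x y _ _ hx hy =>
    rw [map_add, hx, hy]
    split_ifs <;> simp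
  | smul a x _ hx =>
    rw [map_smul, hx]
    split_ifs <;> simp

theorem freeGrading_mul {p q : ZMod 2} {x y : FreeNonUnitalNonAssocAlgebra k X}
    (hx : x ∈ freeGrading k par p) (hy : y ∈ freeGrading k par q) :
    x * y ∈ freeGrading k par (p + q) := by
  induction hx using Submodule.span_induction with
  | mem x hx =>
    obtain ⟨u, rfl, rfl⟩ := hx
    induction hy using Submodule.span_induction with
    | mem y hy =>
      obtain ⟨w, rfl, rfl⟩ := hy
      rw [MonoidAlgebra.single_mul_single]
      exact single_mem par (u * w) _
    | zero =>
      rw [mul_zero]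
      exact zero_mem _
    | add x y _ _ hx hy =>
      rw [mul_add]
      exact add_mem hx hy
    | smul a x _ hx =>
      rw [mul_smul_comm]
      exact Submodule.smul_mem _ _ hx
  | zero =>
    rw [zero_mul]
    exact zero_mem _
  | add x y _ _ hx hy =>
    rw [add_mul]
    exact add_mem hx hy
  | smul a x _ hx =>
    rw [smul_mul_assoc]
    exact Submodule.smul_mem _ _ hx

theorem freeProj_mul (r : ZMod 2) (x y : FreeNonUnitalNonAssocAlgebra k X) :
    freeProj k par r (x * y) = ∑ p, freeProj k par p x * freeProj k par (r - p) y := by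
  conv_lhs => rw [← sum_freeProj par x, Finset.sum_mul, map_sum]
  refine Finset.sum_congr rfl fun p _ => ?_
  conv_lhs => rw [← sum_freeProj par y, Finset.mul_sum, map_sum]
  rw [Finset.sum_eq_single (r - p)]
  · rw [freeProj_of_mem par _ _ (freeGrading_mul par (freeProj_mem par p x)
      (freeProj_mem par (r - p) y)), if_pos (by ring)]
  · intro q _ hq
    rw [freeProj_of_mem par _ _ (freeGrading_mul par (freeProj_mem par p x)
      (freeProj_mem par q y)), if_neg]
    rintro rfl
    exact hq (by ring)
  · simp

theorem lieRel_homogeneous {z : FreeNonUnitalNonAssocAlgebra k X} (hz : LieRel par z) :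
    ∃ p, z ∈ freeGrading k par p := by
  cases hz with
  | @skew p q x y hx hy =>
    refine ⟨p + q, add_mem (freeGrading_mul par hx hy) ?_⟩
    rw [Units.smul_def, add_comm p q]
    exact zsmul_mem (freeGrading_mul par hy hx) _
  | @jacobi p q r x y z hx hy hz =>
    refine ⟨p + q + r, sub_mem (sub_mem ?_ ?_) ?_⟩
    · rw [add_assoc]
      exact freeGrading_mul par hx (freeGrading_mul par hy hz)
    · exact freeGrading_mul par (freeGrading_mul par hx hy) hz
    · rw [Units.smul_def, add_comm p q, add_assoc]
      exact zsmul_mem (freeGrading_mul par hy (freeGrading_mul par hx hz)) _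

variable {rels} in
theorem freeProj_mem_relIdeal (hrels : ∀ z ∈ rels, ∃ p, z ∈ freeGrading k par p) (p : ZMod 2)
    {z : FreeNonUnitalNonAssocAlgebra k X} (hz : z ∈ relIdeal par rels) :
    freeProj k par p z ∈ relIdeal par rels := by
  have hom : ∀ z ∈ relIdeal par rels, (∃ q, z ∈ freeGrading k par q) →
      ∀ p, freeProj k par p z ∈ relIdeal par rels := by
    rintro z hz ⟨q, hq⟩ p
    rw [freeProj_of_mem par q z hq]
    split_ifs
    · exact hz
    · exact zero_mem _
  have key : relIdeal par rels ≤ ⨅ p, (relIdeal par rels).comap (freeProj k par p) := by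
    refine relIdeal_le par rels (fun z hz => ?_) (fun z hz => ?_) fun x y hy => ?_
    · rw [Submodule.mem_iInf]
      exact hom z (relIdeal_of_lieRel par rels hz) (lieRel_homogeneous par hz)
    · rw [SetLike.mem_coe, Submodule.mem_iInf]
      exact hom z (relIdeal_of_rels par rels hz) (hrels z hz)
    · rw [Submodule.mem_iInf] at hy
      simp only [Submodule.mem_iInf, Submodule.mem_comap, freeProj_mul] at hy ⊢
      exact ⟨fun r => sum_mem fun p _ => (relIdeal_mul_mem par rels _ (hy _)).1,
        fun r => sum_mem fun p _ => (relIdeal_mul_mem par rels _ (hy _)).2⟩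
  have h := key hz
  rw [Submodule.mem_iInf] at h
  exact h p

/-- The grading of the quotient by the ideal of relations. -/
def quotGrading (p : ZMod 2) : Submodule k (FreeNonUnitalNonAssocAlgebra k X ⧸ relIdeal par rels) :=
  (freeGrading k par p).map (relIdeal par rels).mkQ

variable {rels} in
theorem quotGrading_isInternal (hrels : ∀ z ∈ rels, ∃ p, z ∈ freeGrading k par p) :
    DirectSum.IsInternal (quotGrading par rels) :=
  @DirectSum.Decomposition.isInternal _ _ _ _ _ _ _ (quotGrading par rels)
    (decompositionOfProj (quotGrading par rels)
      (fun p => (relIdeal par rels).mapQ (relIdeal par rels) (freeProj k par p)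
        fun _ hz => freeProj_mem_relIdeal par hrels p hz)
      (fun p x => by
        obtain ⟨a, rfl⟩ := (relIdeal par rels).mkQ_surjective x
        exact Submodule.mem_map_of_mem (freeProj_mem par p a))
      (fun x => by
        obtain ⟨a, rfl⟩ := (relIdeal par rels).mkQ_surjective x
        simp only [Submodule.mkQ_apply, Submodule.mapQ_apply]
        simp only [← Submodule.mkQ_apply, ← map_sum, sum_freeProj])
      (fun p x hx q => by
        obtain ⟨a, ha, rfl⟩ := hx
        rw [Submodule.mkQ_apply, Submodule.mapQ_apply, freeProj_of_mem par p a ha]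
        split_ifs <;> rfl))

/-- The bracket on the quotient by the ideal of relations, induced by the product of the free
nonassociative algebra. -/
def quotBracket : (FreeNonUnitalNonAssocAlgebra k X ⧸ relIdeal par rels) →ₗ[k]
    (FreeNonUnitalNonAssocAlgebra k X ⧸ relIdeal par rels) →ₗ[k]
      (FreeNonUnitalNonAssocAlgebra k X ⧸ relIdeal par rels) :=
  (relIdeal par rels).liftQ
    (LinearMap.mk₂ k
      (fun (x : FreeNonUnitalNonAssocAlgebra k X)
          (y : FreeNonUnitalNonAssocAlgebra k X ⧸ relIdeal par rels) =>
        (relIdeal par rels).mapQ (relIdeal par rels) (LinearMap.mulLeft k x)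
          (fun _ hz => (relIdeal_mul_mem par rels x hz).1) y)
      (fun x x' y => by
        obtain ⟨b, rfl⟩ := (relIdeal par rels).mkQ_surjective y
        exact congrArg (relIdeal par rels).mkQ (add_mul x x' b))
      (fun c x y => by
        obtain ⟨b, rfl⟩ := (relIdeal par rels).mkQ_surjective y
        exact congrArg (relIdeal par rels).mkQ (smul_mul_assoc c x b))
      (fun x y y' => map_add _ y y')
      (fun c x y => map_smul _ c y))
    (fun x hx => by
      rw [LinearMap.mem_ker]
      ext y
      exact (Submodule.Quotient.mk_eq_zero _).2 (relIdeal_mul_mem par rels _ hx).2)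

theorem quotBracket_mk (x y : FreeNonUnitalNonAssocAlgebra k X) :
    quotBracket par rels ((relIdeal par rels).mkQ x) ((relIdeal par rels).mkQ y) =
      (relIdeal par rels).mkQ (x * y) :=
  rfl

end Presentation

open Presentation in
/-- The Lie superalgebra generated by homogeneous elements of parities `par` subject to the
homogeneous relations `rels`: the quotient of the free nonassociative algebra by the two-sided
ideal generated by super skew-symmetry, the super Jacobi identity and `rels`. -/
def presented {k : Type u} [CommRing k] {X : Type v} (par : X → ZMod 2)
    (rels : Set (FreeNonUnitalNonAssocAlgebra k X))
    (hrels : ∀ z ∈ rels, ∃ p, z ∈ freeGrading k par p) : LieSuperalgebra.{u, max u v} k where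
  carrier := FreeNonUnitalNonAssocAlgebra k X ⧸ relIdeal par rels
  grading := quotGrading par rels
  isInternal := quotGrading_isInternal par hrels
  bracket := quotBracket par rels
  bracket_mem := by
    rintro p q _ _ ⟨a, ha, rfl⟩ ⟨b, hb, rfl⟩
    exact Submodule.mem_map_of_mem (freeGrading_mul par ha hb)
  skew := by
    rintro p q _ _ ⟨a, ha, rfl⟩ ⟨b, hb, rfl⟩
    rw [eq_neg_iff_add_eq_zero]
    exact (Submodule.Quotient.mk_eq_zero _).2 (relIdeal_of_lieRel par rels (.skew ha hb))
  jacobi := by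
    rintro p q _ _ ⟨a, ha, rfl⟩ ⟨b, hb, rfl⟩ z
    obtain ⟨c, rfl⟩ := (relIdeal par rels).mkQ_surjective z
    rw [← sum_freeProj par c]
    simp only [map_sum, Finset.smul_sum, ← Finset.sum_add_distrib]
    refine Finset.sum_congr rfl fun r _ => ?_
    rw [← sub_eq_zero, ← sub_sub]
    exact (Submodule.Quotient.mk_eq_zero _).2
      (relIdeal_of_lieRel par rels (.jacobi ha hb (freeProj_mem par r c)))

open Presentation in
/-- The generators of a presented Lie superalgebra. -/
def presented.gen {k : Type u} [CommRing k] {X : Type v} (par : X → ZMod 2)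
    (rels : Set (FreeNonUnitalNonAssocAlgebra k X))
    (hrels : ∀ z ∈ rels, ∃ p, z ∈ freeGrading k par p) (x : X) :
    (presented par rels hrels).carrier :=
  (relIdeal par rels).mkQ (FreeNonUnitalNonAssocAlgebra.of k x)

section Homogeneous

variable {k : Type u} [CommRing k] {R : Type v} [Ring R] [Algebra k R]
variable (ℛ : ZMod 2 → Submodule k R) [GradedAlgebra ℛ] {p q : ZMod 2}

/-- The product of two homogeneous elements. -/
def hmul (a : ℛ p) (b : ℛ q) : ℛ (p + q) :=
  ⟨a * b, SetLike.mul_mem_graded a.2 b.2⟩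

/-- The parity map on a homogeneous component. -/
def hrho (a : ℛ p) : ℛ p :=
  ⟨rho ℛ a, rho_mem a.2⟩

end Homogeneous

/-! ### The Steinberg Lie superalgebra `st_{m|n}(S)` -/

section St

variable {k : Type u} [CommRing k] {S : Type v} [Ring S] [Algebra k S]

/-- The parity of the row and column indices of `(m|n)`-matrices. -/
def indexParity {m n : ℕ} : Fin m ⊕ Fin n → ZMod 2
  | .inl _ => 0
  | .inr _ => 1

/-- The generators `e_{ij}(a)` of the Steinberg Lie superalgebra, for `i ≠ j` and `a` homogeneous
of parity `p`. -/
inductive StGen (𝒮 : ZMod 2 → Submodule k S) (m n : ℕ) : Type v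
  | e (i j : Fin m ⊕ Fin n) (hij : i ≠ j) (p : ZMod 2) (a : 𝒮 p) : StGen 𝒮 m n

/-- The parity of `e_{ij}(a)` is `|i| + |j| + |a|`. -/
def StGen.parity {𝒮 : ZMod 2 → Submodule k S} {m n : ℕ} : StGen 𝒮 m n → ZMod 2
  | .e i j _ p _ => indexParity i + indexParity j + p

variable (𝒮 : ZMod 2 → Submodule k S) [GradedAlgebra 𝒮] (m n : ℕ)

/-- The generator `e_{ij}(a)`, for `a` homogeneous, in the free nonassociative algebra. -/
def stE {m n : ℕ} (i j : Fin m ⊕ Fin n) (hij : i ≠ j) {p : ZMod 2} (a : 𝒮 p) :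
    FreeNonUnitalNonAssocAlgebra k (StGen 𝒮 m n) :=
  FreeNonUnitalNonAssocAlgebra.of k (.e i j hij p a)

/-- The defining relations of the Steinberg Lie superalgebra. -/
inductive StRel : FreeNonUnitalNonAssocAlgebra k (StGen 𝒮 m n) → Prop
  | add (i j) (hij : i ≠ j) (p) (a b : 𝒮 p) :
      StRel (stE 𝒮 i j hij (a + b) - stE 𝒮 i j hij a - stE 𝒮 i j hij b)
  | smul (i j) (hij : i ≠ j) (p) (c : k) (a : 𝒮 p) :
      StRel (stE 𝒮 i j hij (c • a) - c • stE 𝒮 i j hij a)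
  | ee (i j l) (hij : i ≠ j) (hjl : j ≠ l) (hil : i ≠ l) (p q) (a : 𝒮 p) (b : 𝒮 q) :
      StRel (stE 𝒮 i j hij a * stE 𝒮 j l hjl b - stE 𝒮 i l hil (hmul 𝒮 a b))
  | ee_zero (i j l r) (hij : i ≠ j) (_ : j ≠ l) (hlr : l ≠ r) (_ : r ≠ i) (p q)
      (a : 𝒮 p) (b : 𝒮 q) :
      StRel (stE 𝒮 i j hij a * stE 𝒮 l r hlr b)

open Presentation in
theorem stE_mem {m n : ℕ} (i j : Fin m ⊕ Fin n) (hij : i ≠ j) {p : ZMod 2} (a : 𝒮 p) :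
    stE 𝒮 i j hij a ∈
      freeGrading k (StGen.parity (𝒮 := 𝒮)) (indexParity i + indexParity j + p) :=
  of_mem (StGen.parity (𝒮 := 𝒮)) (.e i j hij p a)

open Presentation in
theorem stRel_homogeneous (z : FreeNonUnitalNonAssocAlgebra k (StGen 𝒮 m n))
    (hz : z ∈ {z | StRel 𝒮 m n z}) :
    ∃ p, z ∈ freeGrading k (StGen.parity (𝒮 := 𝒮)) p := by
  cases hz with
  | add => exact ⟨_, sub_mem (sub_mem (stE_mem _ _ _ _ _) (stE_mem _ _ _ _ _)) (stE_mem _ _ _ _ _)⟩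
  | smul => exact ⟨_, sub_mem (stE_mem _ _ _ _ _) (Submodule.smul_mem _ _ (stE_mem _ _ _ _ _))⟩
  | ee i j l hij hjl hil p q a b =>
    refine ⟨_, sub_mem (freeGrading_mul _ (stE_mem _ _ _ _ _) (stE_mem _ _ _ _ _)) ?_⟩
    convert stE_mem 𝒮 i l hil (hmul 𝒮 a b) using 2
    linear_combination CharTwo.add_self_eq_zero (indexParity j)
  | ee_zero => exact ⟨_, freeGrading_mul _ (stE_mem _ _ _ _ _) (stE_mem _ _ _ _ _)⟩

/-- The Steinberg Lie superalgebra `st_{m|n}(S)`. -/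
def st : LieSuperalgebra k :=
  presented (StGen.parity (𝒮 := 𝒮)) {z | StRel 𝒮 m n z} (stRel_homogeneous 𝒮 m n)

/-- The element `e_{ij}(a)` of `st_{m|n}(S)`, for an arbitrary `a`, by linear extension. -/
def st.e {m n : ℕ} (i j : Fin m ⊕ Fin n) (hij : i ≠ j) (a : S) : (st 𝒮 m n).carrier :=
  ∑ p : ZMod 2, presented.gen _ _ (stRel_homogeneous 𝒮 m n) (.e i j hij p (decompose 𝒮 a p))

end St

/-! ### The Steinberg periplectic Lie superalgebra `stp_m(R, bar)` -/

section Stp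

variable {k : Type u} [CommRing k] {R : Type v} [Ring R] [Algebra k R]

/-- The generators of the Steinberg periplectic Lie superalgebra: `t_{ij}(a)`, `f_{ij}(a)` and
`g_{ij}(a)`, for `i ≠ j` and `a` homogeneous of parity `p`. -/
inductive StpGen (ℛ : ZMod 2 → Submodule k R) (m : ℕ) : Type v
  | t (i j : Fin m) (hij : i ≠ j) (p : ZMod 2) (a : ℛ p) : StpGen ℛ m
  | f (i j : Fin m) (hij : i ≠ j) (p : ZMod 2) (a : ℛ p) : StpGen ℛ m
  | g (i j : Fin m) (hij : i ≠ j) (p : ZMod 2) (a : ℛ p) : StpGen ℛ m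

/-- The parities of `t_{ij}(a)`, `f_{ij}(a)`, `g_{ij}(a)` are `|a|`, `|a| + 1`, `|a| + 1`. -/
def StpGen.parity {ℛ : ZMod 2 → Submodule k R} {m : ℕ} : StpGen ℛ m → ZMod 2
  | .t _ _ _ p _ => p
  | .f _ _ _ p _ => p + 1
  | .g _ _ _ p _ => p + 1

section

variable (ℛ : ZMod 2 → Submodule k R) {m : ℕ} (i j : Fin m) (hij : i ≠ j) {p : ZMod 2} (a : ℛ p)

/-- The generator `t_{ij}(a)`, for `a` homogeneous, in the free nonassociative algebra. -/
def stpT : FreeNonUnitalNonAssocAlgebra k (StpGen ℛ m) :=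
  FreeNonUnitalNonAssocAlgebra.of k (.t i j hij p a)

/-- The generator `f_{ij}(a)`, for `a` homogeneous, in the free nonassociative algebra. -/
def stpF : FreeNonUnitalNonAssocAlgebra k (StpGen ℛ m) :=
  FreeNonUnitalNonAssocAlgebra.of k (.f i j hij p a)

/-- The generator `g_{ij}(a)`, for `a` homogeneous, in the free nonassociative algebra. -/
def stpG : FreeNonUnitalNonAssocAlgebra k (StpGen ℛ m) :=
  FreeNonUnitalNonAssocAlgebra.of k (.g i j hij p a)

open Presentation in
theorem stpT_mem : stpT ℛ i j hij a ∈ freeGrading k (StpGen.parity (ℛ := ℛ)) p :=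
  of_mem (StpGen.parity (ℛ := ℛ)) (.t i j hij p a)

open Presentation in
theorem stpF_mem : stpF ℛ i j hij a ∈ freeGrading k (StpGen.parity (ℛ := ℛ)) (p + 1) :=
  of_mem (StpGen.parity (ℛ := ℛ)) (.f i j hij p a)

open Presentation in
theorem stpG_mem : stpG ℛ i j hij a ∈ freeGrading k (StpGen.parity (ℛ := ℛ)) (p + 1) :=
  of_mem (StpGen.parity (ℛ := ℛ)) (.g i j hij p a)

end

/-- The superinvolution on a homogeneous component. -/
def hbar {ℛ : ZMod 2 → Submodule k R} (σ : Superinvolution ℛ) {p : ZMod 2} (a : ℛ p) : ℛ p :=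
  ⟨σ.bar a, σ.bar_mem a.2⟩

variable {ℛ : ZMod 2 → Submodule k R} [GradedAlgebra ℛ] (σ : Superinvolution ℛ) (m : ℕ)

/-- The defining relations of the Steinberg periplectic Lie superalgebra. -/
inductive StpRel : FreeNonUnitalNonAssocAlgebra k (StpGen ℛ m) → Prop
  | t_add (i j) (hij : i ≠ j) (p) (a b : ℛ p) :
      StpRel (stpT ℛ i j hij (a + b) - stpT ℛ i j hij a - stpT ℛ i j hij b)
  | t_smul (i j) (hij : i ≠ j) (p) (c : k) (a : ℛ p) :
      StpRel (stpT ℛ i j hij (c • a) - c • stpT ℛ i j hij a)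
  | f_add (i j) (hij : i ≠ j) (p) (a b : ℛ p) :
      StpRel (stpF ℛ i j hij (a + b) - stpF ℛ i j hij a - stpF ℛ i j hij b)
  | f_smul (i j) (hij : i ≠ j) (p) (c : k) (a : ℛ p) :
      StpRel (stpF ℛ i j hij (c • a) - c • stpF ℛ i j hij a)
  | g_add (i j) (hij : i ≠ j) (p) (a b : ℛ p) :
      StpRel (stpG ℛ i j hij (a + b) - stpG ℛ i j hij a - stpG ℛ i j hij b)
  | g_smul (i j) (hij : i ≠ j) (p) (c : k) (a : ℛ p) :
      StpRel (stpG ℛ i j hij (c • a) - c • stpG ℛ i j hij a)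
  | f_bar (i j) (hij : i ≠ j) (p) (a : ℛ p) :
      StpRel (stpF ℛ i j hij (hbar σ a) - stpF ℛ j i hij.symm (hrho ℛ a))
  | g_bar (i j) (hij : i ≠ j) (p) (a : ℛ p) :
      StpRel (stpG ℛ i j hij (hbar σ a) + stpG ℛ j i hij.symm (hrho ℛ a))
  | tt (i j l) (hij : i ≠ j) (hjl : j ≠ l) (hil : i ≠ l) (p q) (a : ℛ p) (b : ℛ q) :
      StpRel (stpT ℛ i j hij a * stpT ℛ j l hjl b - stpT ℛ i l hil (hmul ℛ a b))
  | tt_zero (i j l r) (hij : i ≠ j) (_ : j ≠ l) (hlr : l ≠ r) (_ : r ≠ i) (p q)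
      (a : ℛ p) (b : ℛ q) :
      StpRel (stpT ℛ i j hij a * stpT ℛ l r hlr b)
  | tf (i j l) (hij : i ≠ j) (hjl : j ≠ l) (hil : i ≠ l) (p q) (a : ℛ p) (b : ℛ q) :
      StpRel (stpT ℛ i j hij a * stpF ℛ j l hjl b - stpF ℛ i l hil (hmul ℛ a b))
  | tf_zero (i j l r) (hij : i ≠ j) (_ : j ≠ l) (hlr : l ≠ r) (_ : r ≠ j) (p q)
      (a : ℛ p) (b : ℛ q) :
      StpRel (stpT ℛ i j hij a * stpF ℛ l r hlr b)
  | gt (i j l) (hij : i ≠ j) (hjl : j ≠ l) (hil : i ≠ l) (p q) (a : ℛ p) (b : ℛ q) :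
      StpRel (stpG ℛ i j hij a * stpT ℛ j l hjl b - stpG ℛ i l hil (hmul ℛ a b))
  | gt_zero (i j l r) (hij : i ≠ j) (_ : l ≠ j) (hlr : l ≠ r) (_ : i ≠ l) (p q)
      (a : ℛ p) (b : ℛ q) :
      StpRel (stpG ℛ i j hij a * stpT ℛ l r hlr b)
  | ff_zero (i j l r) (hij : i ≠ j) (hlr : l ≠ r) (p q) (a : ℛ p) (b : ℛ q) :
      StpRel (stpF ℛ i j hij a * stpF ℛ l r hlr b)
  | gg_zero (i j l r) (hij : i ≠ j) (hlr : l ≠ r) (p q) (a : ℛ p) (b : ℛ q) :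
      StpRel (stpG ℛ i j hij a * stpG ℛ l r hlr b)
  | fg (i j l) (hij : i ≠ j) (hjl : j ≠ l) (hil : i ≠ l) (p q) (a : ℛ p) (b : ℛ q) :
      StpRel (stpF ℛ i j hij a * stpG ℛ j l hjl b - stpT ℛ i l hil (hmul ℛ a b))
  | fg_zero (i j l r) (hij : i ≠ j) (_ : i ≠ l) (_ : i ≠ r) (_ : j ≠ l) (_ : j ≠ r)
      (hlr : l ≠ r) (p q) (a : ℛ p) (b : ℛ q) :
      StpRel (stpF ℛ i j hij a * stpG ℛ l r hlr b)

open Presentation in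
theorem stpRel_homogeneous (z : FreeNonUnitalNonAssocAlgebra k (StpGen ℛ m))
    (hz : z ∈ {z | StpRel σ m z}) :
    ∃ p, z ∈ freeGrading k (StpGen.parity (ℛ := ℛ)) p := by
  cases hz with
  | t_add => exact ⟨_, sub_mem (sub_mem (stpT_mem _ _ _ _ _) (stpT_mem _ _ _ _ _)) (stpT_mem _ _ _ _ _)⟩
  | f_add => exact ⟨_, sub_mem (sub_mem (stpF_mem _ _ _ _ _) (stpF_mem _ _ _ _ _)) (stpF_mem _ _ _ _ _)⟩
  | g_add => exact ⟨_, sub_mem (sub_mem (stpG_mem _ _ _ _ _) (stpG_mem _ _ _ _ _)) (stpG_mem _ _ _ _ _)⟩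
  | t_smul => exact ⟨_, sub_mem (stpT_mem _ _ _ _ _) (Submodule.smul_mem _ _ (stpT_mem _ _ _ _ _))⟩
  | f_smul => exact ⟨_, sub_mem (stpF_mem _ _ _ _ _) (Submodule.smul_mem _ _ (stpF_mem _ _ _ _ _))⟩
  | g_smul => exact ⟨_, sub_mem (stpG_mem _ _ _ _ _) (Submodule.smul_mem _ _ (stpG_mem _ _ _ _ _))⟩
  | f_bar => exact ⟨_, sub_mem (stpF_mem _ _ _ _ _) (stpF_mem _ _ _ _ _)⟩
  | g_bar => exact ⟨_, add_mem (stpG_mem _ _ _ _ _) (stpG_mem _ _ _ _ _)⟩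
  | tt => exact ⟨_, sub_mem (freeGrading_mul _ (stpT_mem _ _ _ _ _) (stpT_mem _ _ _ _ _)) (stpT_mem _ _ _ _ _)⟩
  | tf i j l hij hjl hil p q a b =>
    refine ⟨_, sub_mem (freeGrading_mul _ (stpT_mem _ _ _ _ _) (stpF_mem _ _ _ _ _)) ?_⟩
    rw [← add_assoc]
    exact stpF_mem _ _ _ _ _
  | gt i j l hij hjl hil p q a b =>
    refine ⟨_, sub_mem (freeGrading_mul _ (stpG_mem _ _ _ _ _) (stpT_mem _ _ _ _ _)) ?_⟩
    rw [add_right_comm]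
    exact stpG_mem _ _ _ _ _
  | fg i j l hij hjl hil p q a b =>
    refine ⟨_, sub_mem (freeGrading_mul _ (stpF_mem _ _ _ _ _) (stpG_mem _ _ _ _ _)) ?_⟩
    rw [add_add_add_comm, CharTwo.add_self_eq_zero (1 : ZMod 2), add_zero]
    exact stpT_mem _ _ _ _ _
  | tt_zero => exact ⟨_, freeGrading_mul _ (stpT_mem _ _ _ _ _) (stpT_mem _ _ _ _ _)⟩
  | tf_zero => exact ⟨_, freeGrading_mul _ (stpT_mem _ _ _ _ _) (stpF_mem _ _ _ _ _)⟩
  | gt_zero => exact ⟨_, freeGrading_mul _ (stpG_mem _ _ _ _ _) (stpT_mem _ _ _ _ _)⟩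
  | ff_zero => exact ⟨_, freeGrading_mul _ (stpF_mem _ _ _ _ _) (stpF_mem _ _ _ _ _)⟩
  | gg_zero => exact ⟨_, freeGrading_mul _ (stpG_mem _ _ _ _ _) (stpG_mem _ _ _ _ _)⟩
  | fg_zero => exact ⟨_, freeGrading_mul _ (stpF_mem _ _ _ _ _) (stpG_mem _ _ _ _ _)⟩

/-- The Steinberg periplectic Lie superalgebra `stp_m(R, bar)`. -/
def stp : LieSuperalgebra k :=
  presented (StpGen.parity (ℛ := ℛ)) {z | StpRel σ m z} (stpRel_homogeneous σ m)

variable {m} (i j : Fin m) (hij : i ≠ j) (a : R)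

/-- The element `t_{ij}(a)` of `stp_m(R, bar)`, for an arbitrary `a`, by linear extension. -/
def stp.t : (stp σ m).carrier :=
  ∑ p : ZMod 2, presented.gen _ _ (stpRel_homogeneous σ m) (.t i j hij p (decompose ℛ a p))

/-- The element `f_{ij}(a)` of `stp_m(R, bar)`, for an arbitrary `a`, by linear extension. -/
def stp.f : (stp σ m).carrier :=
  ∑ p : ZMod 2, presented.gen _ _ (stpRel_homogeneous σ m) (.f i j hij p (decompose ℛ a p))

/-- The element `g_{ij}(a)` of `stp_m(R, bar)`, for an arbitrary `a`, by linear extension. -/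
def stp.g : (stp σ m).carrier :=
  ∑ p : ZMod 2, presented.gen _ _ (stpRel_homogeneous σ m) (.g i j hij p (decompose ℛ a p))

end Stp

end Steinberg

end

/-! An index of an `(m|m)`-matrix is `i` or `m+i`; call `i` its base. The positions `(x, y)` with
different bases form four blocks, and they match the generators of the periplectic algebra over `S ⊕
S^op`. The elements `t_{ij}(a ⊕ 0)` and `-t_{ji}(0 ⊕ a)` fill the two diagonal blocks, and `f_{ij}(a
⊕ 0)`, `g_{ij}(a ⊕ 0)` fill the other two. The values of `f` and `g` on `S^op` give nothing new,
since the relation for the superinvolution turns `f_{ij}(0 ⊕ a)` into `f_{ji}(ρ a ⊕ 0)`, and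
likewise for `g` up to sign.

In the direction from `stp` to `st`, the prescribed images of `t`, `f`, `g` are sums of two
elementary root vectors. The periplectic relations are checked term by term: the product relations
need the sign of the opposite product, and in the others no two terms are composable
(`exists_hom_stp_st`).

The other direction is the harder one, because `st` also has generators at `(i, m+i)` and `(m+i,
i)`, which have no counterpart among the periplectic generators. They must be sent to brackets of
two root vectors through an auxiliary index. `IsRootFamily.exists_hom` shows that this is
consistent: any elements satisfying the relations of `st` at positions with different bases extend
to the whole of `st`. Since `m ≥ 3`, the Jacobi identity lets the auxiliary index be changed
(`IsRootFamily.bracket_eq_loop`), and every relation involving the new elements follows from a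
suitable choice of it.

It remains to see that the periplectic generators form such a family (`stp.isRootFamily_root`).
Vanishing brackets not listed among the relations come from `(a ⊕ 0)(0 ⊕ b) = 0` after a flip of
indices, except when both pairs of bases coincide; there one factor is first written as a bracket
through a third index. The two homomorphisms are inverse to each other because their composites fix
generators. -/

noncomputable section

namespace Steinberg

/-! ### Consequences of the axioms of a Lie superalgebra -/

namespace LieSuperalgebra

variable {k : Type u} [CommRing k] (L : LieSuperalgebra.{u, v} k) {p q : ZMod 2}
  {x y z : L.carrier}

theorem bracket_eq_zero_symm (hx : x ∈ L.grading p) (hy : y ∈ L.grading q)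
    (h : L.bracket x y = 0) : L.bracket y x = 0 := by
  rw [L.skew hy hx, h, smul_zero, neg_zero]

/-- If `x` and `z` commute, the bracket of `x`, `y`, `z` is associative. -/
theorem bracket_assoc (hx : x ∈ L.grading p) (hy : y ∈ L.grading q) (h : L.bracket x z = 0) :
    L.bracket (L.bracket x y) z = L.bracket x (L.bracket y z) := by
  rw [L.jacobi hx hy, h, map_zero, smul_zero, add_zero]

/-- By the Jacobi identity, what a homogeneous `x` annihilates is closed under brackets. All
vanishing relations for elements defined as brackets are reduced to this. -/
theorem bracket_bracket_eq_zero (hx : x ∈ L.grading p) (hy : y ∈ L.grading q)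
    (h₁ : L.bracket x y = 0) (h₂ : L.bracket x z = 0) : L.bracket x (L.bracket y z) = 0 := by
  rw [L.jacobi hx hy, h₁, h₂, map_zero, map_zero, LinearMap.zero_apply, smul_zero, add_zero]

/-- The nonassociative algebra underlying a Lie superalgebra. -/
def Alg : Type v := L.carrier

instance : NonUnitalNonAssocRing L.Alg where
  __ := (inferInstanceAs (AddCommGroup L.carrier) : AddCommGroup L.Alg)
  mul (x y : L.carrier) := L.bracket x y
  left_distrib (x y z : L.carrier) := map_add (L.bracket x) y z
  right_distrib (x y z : L.carrier) := L.bracket.map_add₂ x y z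
  zero_mul (x : L.carrier) := L.bracket.map_zero₂ x
  mul_zero (x : L.carrier) := map_zero (L.bracket x)

instance : Module k L.Alg := inferInstanceAs (Module k L.carrier)

instance : IsScalarTower k L.Alg L.Alg where
  smul_assoc c (x y : L.carrier) := L.bracket.map_smul₂ c x y

instance : SMulCommClass k L.Alg L.Alg where
  smul_comm c (x y : L.carrier) := (map_smul (L.bracket x) c y).symm

end LieSuperalgebra

/-! ### The universal property of a presented Lie superalgebra -/

namespace Presentation

variable {k : Type u} [CommRing k] {X : Type v} {par : X → ZMod 2}
  (L : LieSuperalgebra.{u, max u v} k) (f : X → L.carrier)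

/-- The evaluation of nonassociative polynomials in a Lie superalgebra. -/
def freeEval : FreeNonUnitalNonAssocAlgebra k X →ₗ[k] L.carrier :=
  (FreeNonUnitalNonAssocAlgebra.lift k (A := L.Alg) f : _ →ₗ[k] L.Alg)

theorem freeEval_of (x : X) : freeEval L f (FreeNonUnitalNonAssocAlgebra.of k x) = f x :=
  FreeNonUnitalNonAssocAlgebra.lift_of_apply k (A := L.Alg) f x

theorem freeEval_mul (x y : FreeNonUnitalNonAssocAlgebra k X) :
    freeEval L f (x * y) = L.bracket (freeEval L f x) (freeEval L f y) :=
  map_mul (FreeNonUnitalNonAssocAlgebra.lift k (A := L.Alg) f) x y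

variable {f}

/-- Each homogeneous component of the free algebra is spanned by monomials, so evenness is an
induction on words. -/
theorem freeEval_mem (hf : ∀ x, f x ∈ L.grading (par x)) {p : ZMod 2}
    {x : FreeNonUnitalNonAssocAlgebra k X} (hx : x ∈ freeGrading k par p) :
    freeEval L f x ∈ L.grading p := by
  have key : ∀ w : FreeMagma X,
      freeEval L f (MonoidAlgebra.single w 1) ∈ L.grading (wordParity par w) := by
    intro w
    induction w using FreeMagma.recOnMul with
    | ih1 x =>
      have h := freeEval_of L f x
      rw [FreeNonUnitalNonAssocAlgebra.of] at h
      exact h ▸ hf x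
    | ih2 v w hv hw =>
      have h : (MonoidAlgebra.single (v * w) 1 : FreeNonUnitalNonAssocAlgebra k X) =
          MonoidAlgebra.single v 1 * MonoidAlgebra.single w 1 := by
        rw [MonoidAlgebra.single_mul_single, mul_one]
      rw [h, freeEval_mul]
      exact L.bracket_mem hv hw
  induction hx using Submodule.span_induction with
  | mem x hx =>
    obtain ⟨w, rfl, rfl⟩ := hx
    exact key w
  | zero => simp
  | add x y _ _ hx hy =>
    rw [map_add]
    exact add_mem hx hy
  | smul c x _ hx =>
    rw [map_smul]
    exact Submodule.smul_mem _ _ hx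

/-- The kernel of the evaluation is a two-sided ideal containing `rels`, and it contains the
skew-symmetry and Jacobi elements because `L` satisfies these axioms; `relIdeal` is the smallest
such ideal. -/
theorem relIdeal_le_ker (hf : ∀ x, f x ∈ L.grading (par x))
    {rels : Set (FreeNonUnitalNonAssocAlgebra k X)} (h : ∀ z ∈ rels, freeEval L f z = 0) :
    relIdeal par rels ≤ LinearMap.ker (freeEval L f) := by
  refine relIdeal_le par rels (fun z hz => ?_) h fun x y hy => ?_
  · cases hz with
    | skew hx hy =>
      rw [LinearMap.mem_ker, map_add, Units.smul_def, map_zsmul, freeEval_mul, freeEval_mul,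
        L.skew (freeEval_mem L hf hx) (freeEval_mem L hf hy), Units.smul_def, neg_add_cancel]
    | jacobi hx hy _ =>
      rw [LinearMap.mem_ker, map_sub, map_sub, Units.smul_def, map_zsmul]
      simp only [freeEval_mul]
      rw [L.jacobi (freeEval_mem L hf hx) (freeEval_mem L hf hy), Units.smul_def]
      abel
  · rw [LinearMap.mem_ker] at hy
    simp [freeEval_mul, hy]

end Presentation

namespace presented

open Presentation

variable {k : Type u} [CommRing k] {X : Type v} {par : X → ZMod 2}
  {rels : Set (FreeNonUnitalNonAssocAlgebra k X)}
  (hrels : ∀ z ∈ rels, ∃ p, z ∈ freeGrading k par p)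

/-- The projection of the free nonassociative algebra onto a presented Lie superalgebra. -/
def mk : FreeNonUnitalNonAssocAlgebra k X →ₗ[k] (presented par rels hrels).carrier :=
  (relIdeal par rels).mkQ

theorem mk_mul (x y : FreeNonUnitalNonAssocAlgebra k X) :
    mk hrels (x * y) = (presented par rels hrels).bracket (mk hrels x) (mk hrels y) := rfl

theorem mk_eq_zero {z : FreeNonUnitalNonAssocAlgebra k X} (hz : z ∈ rels) : mk hrels z = 0 :=
  (Submodule.Quotient.mk_eq_zero _).2 (relIdeal_of_rels par rels hz)

theorem gen_mem (x : X) : gen par rels hrels x ∈ (presented par rels hrels).grading (par x) :=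
  show (relIdeal par rels).mkQ _ ∈ quotGrading par rels (par x) from
    Submodule.mem_map_of_mem (of_mem par x)

/-- A map from the generators to a Lie superalgebra that respects the parities and the relations
extends to a homomorphism. -/
def lift (L : LieSuperalgebra.{u, max u v} k) (f : X → L.carrier)
    (hf : ∀ x, f x ∈ L.grading (par x)) (h : ∀ z ∈ rels, freeEval L f z = 0) :
    (presented par rels hrels).Hom L where
  toLinearMap := (relIdeal par rels).liftQ (freeEval L f) (relIdeal_le_ker L hf h)
  map_mem := by
    rintro p _ ⟨a, ha, rfl⟩
    exact freeEval_mem L hf ha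
  map_bracket x y := by
    obtain ⟨a, rfl⟩ := (relIdeal par rels).mkQ_surjective x
    obtain ⟨b, rfl⟩ := (relIdeal par rels).mkQ_surjective y
    exact freeEval_mul L f a b

theorem lift_gen (L : LieSuperalgebra.{u, max u v} k) (f : X → L.carrier)
    (hf : ∀ x, f x ∈ L.grading (par x)) (h : ∀ z ∈ rels, freeEval L f z = 0) (x : X) :
    lift hrels L f hf h (gen par rels hrels x) = f x :=
  freeEval_of L f x

/-- A linear endomorphism compatible with the bracket and fixing the generators is the identity. -/
theorem eq_self_of_gen (f : (presented par rels hrels).carrier →ₗ[k]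
      (presented par rels hrels).carrier)
    (hf : ∀ x y, f ((presented par rels hrels).bracket x y) =
      (presented par rels hrels).bracket (f x) (f y))
    (h : ∀ x, f (gen par rels hrels x) = gen par rels hrels x)
    (x : (presented par rels hrels).carrier) : f x = x := by
  -- Monomials span the free algebra, so it suffices to induct on the length of a word.
  have key : ∀ w : FreeMagma X, f (mk hrels (MonoidAlgebra.single w 1)) =
      mk hrels (MonoidAlgebra.single w 1) := by
    intro w
    induction w using FreeMagma.recOnMul with
    | ih1 x => exact h x
    | ih2 v w hv hw =>
      have e : (MonoidAlgebra.single (v * w) 1 : FreeNonUnitalNonAssocAlgebra k X) =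
          MonoidAlgebra.single v 1 * MonoidAlgebra.single w 1 := by
        rw [MonoidAlgebra.single_mul_single, mul_one]
      rw [e, mk_mul, hf, hv, hw]
  obtain ⟨a, rfl⟩ : ∃ a, mk hrels a = x := (relIdeal par rels).mkQ_surjective x
  induction a using MonoidAlgebra.induction_linear with
  | zero => simp
  | add a b ha hb => rw [map_add, map_add, ha, hb]
  | single w r =>
    have e : (MonoidAlgebra.single w r : FreeNonUnitalNonAssocAlgebra k X) =
        r • MonoidAlgebra.single w 1 := by
      rw [MonoidAlgebra.smul_single, smul_eq_mul, mul_one]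
    rw [e, map_smul, map_smul, key]

end presented

/-! ### Linear extension from homogeneous elements -/

section LinearExtension

variable {k : Type u} [CommRing k]
  {M N P : Type*} [AddCommGroup M] [Module k M] [AddCommGroup N] [Module k N]
  [AddCommGroup P] [Module k P]
  (𝒜 : ZMod 2 → Submodule k M) [DirectSum.Decomposition 𝒜]
  (ℬ : ZMod 2 → Submodule k N) [DirectSum.Decomposition ℬ]

/-- The linear extension of a family of maps on the homogeneous components. -/
def linearExtension (g : ∀ p, 𝒜 p → P) (hadd : ∀ p a b, g p (a + b) = g p a + g p b)
    (hsmul : ∀ p (c : k) a, g p (c • a) = c • g p a) : M →ₗ[k] P where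
  toFun a := ∑ p, g p (decompose 𝒜 a p)
  map_add' a b := by simp [decompose_add, hadd, Finset.sum_add_distrib]
  map_smul' c a := by
    simp only [decompose_smul, DirectSum.smul_apply, hsmul, Finset.smul_sum, RingHom.id_apply]

variable {𝒜} in
theorem linearExtension_of_mem (g : ∀ p, 𝒜 p → P) (hadd hsmul) {p : ZMod 2} {a : M}
    (ha : a ∈ 𝒜 p) : linearExtension (k := k) 𝒜 g hadd hsmul a = g p ⟨a, ha⟩ := by
  change ∑ q, g q (decompose 𝒜 a q) = _
  rw [Finset.sum_eq_single p]
  · congr 1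
    exact Subtype.ext (decompose_of_mem_same 𝒜 ha)
  · intro q _ hq
    have h : decompose 𝒜 a q = 0 := Subtype.ext (decompose_of_mem_ne 𝒜 ha hq.symm)
    -- The maps `g q` are not bundled as linear; that they vanish at `0` is homogeneity with scalar
    -- `0`.
    have h0 := hsmul q 0 0
    rwa [zero_smul, zero_smul, ← h] at h0
  · simp

theorem linearMap_eq_of_homogeneous {f g : M →ₗ[k] P}
    (h : ∀ p, ∀ a ∈ 𝒜 p, f a = g a) (a : M) : f a = g a := by
  rw [← sum_gproj 𝒜 a, map_sum, map_sum]
  exact Finset.sum_congr rfl fun p _ => h p _ (gproj_mem 𝒜 p a)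

/-- The presentations impose their relations on homogeneous arguments only; this carries them over
to arbitrary ones, one variable at a time. -/
theorem bilinear_eq_of_homogeneous {f g : M →ₗ[k] N →ₗ[k] P}
    (h : ∀ p q, ∀ a ∈ 𝒜 p, ∀ b ∈ ℬ q, f a b = g a b) (a : M) (b : N) : f a b = g a b := by
  refine linearMap_eq_of_homogeneous 𝒜 (f := f.flip b) (g := g.flip b) (fun p a ha => ?_) a
  exact linearMap_eq_of_homogeneous ℬ (fun q b hb => h p q a ha b hb) b

end LinearExtension

/-! ### The Steinberg Lie superalgebra -/

section St

variable {k : Type u} [CommRing k] {S : Type v} [Ring S] [Algebra k S]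
  (𝒮 : ZMod 2 → Submodule k S) [GradedAlgebra 𝒮] {m n : ℕ}

variable (m n) in
/-- The projection of the free nonassociative algebra onto `st_{m|n}(S)`. -/
def st.mk : FreeNonUnitalNonAssocAlgebra k (StGen 𝒮 m n) →ₗ[k] (st 𝒮 m n).carrier :=
  presented.mk (stRel_homogeneous 𝒮 m n)

theorem st.mk_mul (x y : FreeNonUnitalNonAssocAlgebra k (StGen 𝒮 m n)) :
    st.mk 𝒮 m n (x * y) = (st 𝒮 m n).bracket (st.mk 𝒮 m n x) (st.mk 𝒮 m n y) := rfl

variable {𝒮} in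
theorem st.mk_eq_zero {z : FreeNonUnitalNonAssocAlgebra k (StGen 𝒮 m n)} (hz : StRel 𝒮 m n z) :
    st.mk 𝒮 m n z = 0 :=
  presented.mk_eq_zero (stRel_homogeneous 𝒮 m n) hz

/-- The map `a ↦ e_{ij}(a)`, as a linear map. -/
def st.eLin (i j : Fin m ⊕ Fin n) (hij : i ≠ j) : S →ₗ[k] (st 𝒮 m n).carrier :=
  linearExtension 𝒮 (fun p a => st.mk 𝒮 m n (stE 𝒮 i j hij a))
    (fun p a b => by
      have h := st.mk_eq_zero (StRel.add i j hij p a b)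
      rwa [map_sub, map_sub, sub_sub, sub_eq_zero] at h)
    (fun p c a => by
      have h := st.mk_eq_zero (StRel.smul i j hij p c a)
      rwa [map_sub, map_smul, sub_eq_zero] at h)

variable {𝒮} in
theorem st.eLin_of_mem (i j : Fin m ⊕ Fin n) (hij : i ≠ j) {p : ZMod 2} {a : S} (ha : a ∈ 𝒮 p) :
    st.eLin 𝒮 i j hij a = st.mk 𝒮 m n (stE 𝒮 i j hij ⟨a, ha⟩) :=
  linearExtension_of_mem _ _ _ ha

variable {𝒮} in
theorem st.eLin_mem (i j : Fin m ⊕ Fin n) (hij : i ≠ j) {p : ZMod 2} {a : S} (ha : a ∈ 𝒮 p) :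
    st.eLin 𝒮 i j hij a ∈ (st 𝒮 m n).grading (indexParity i + indexParity j + p) := by
  rw [st.eLin_of_mem i j hij ha]
  exact presented.gen_mem (stRel_homogeneous 𝒮 m n) (.e i j hij p ⟨a, ha⟩)

theorem st.bracket_eLin {i j l : Fin m ⊕ Fin n} (hij : i ≠ j) (hjl : j ≠ l) (hil : i ≠ l)
    (a b : S) : (st 𝒮 m n).bracket (st.eLin 𝒮 i j hij a) (st.eLin 𝒮 j l hjl b) =
      st.eLin 𝒮 i l hil (a * b) := by
  -- Once both sides are packaged as bilinear maps, only homogeneous arguments remain, and for these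
  -- the identity is a defining relation. The same pattern gives all bracket formulas for `stp`
  -- below.
  refine bilinear_eq_of_homogeneous 𝒮 𝒮
    (f := (st 𝒮 m n).bracket.compl₁₂ (st.eLin 𝒮 i j hij) (st.eLin 𝒮 j l hjl))
    (g := (LinearMap.mul k S).compr₂ (st.eLin 𝒮 i l hil)) (fun p q a ha b hb => ?_) a b
  change (st 𝒮 m n).bracket (st.eLin 𝒮 i j hij a) (st.eLin 𝒮 j l hjl b) =
      st.eLin 𝒮 i l hil (a * b)
  rw [st.eLin_of_mem i j hij ha, st.eLin_of_mem j l hjl hb,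
    st.eLin_of_mem i l hil (SetLike.mul_mem_graded ha hb), ← sub_eq_zero,
    ← st.mk_mul, ← map_sub]
  exact st.mk_eq_zero (StRel.ee i j l hij hjl hil p q ⟨a, ha⟩ ⟨b, hb⟩)

theorem st.bracket_eLin_zero {i j l r : Fin m ⊕ Fin n} (hij : i ≠ j) (hjl : j ≠ l) (hlr : l ≠ r)
    (hri : r ≠ i) (a b : S) :
    (st 𝒮 m n).bracket (st.eLin 𝒮 i j hij a) (st.eLin 𝒮 l r hlr b) = 0 := by
  refine bilinear_eq_of_homogeneous 𝒮 𝒮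
    (f := (st 𝒮 m n).bracket.compl₁₂ (st.eLin 𝒮 i j hij) (st.eLin 𝒮 l r hlr))
    (g := 0) (fun p q a ha b hb => ?_) a b
  change (st 𝒮 m n).bracket (st.eLin 𝒮 i j hij a) (st.eLin 𝒮 l r hlr b) = 0
  rw [st.eLin_of_mem i j hij ha, st.eLin_of_mem l r hlr hb, ← st.mk_mul]
  exact st.mk_eq_zero (StRel.ee_zero i j l r hij hjl hlr hri p q ⟨a, ha⟩ ⟨b, hb⟩)

variable {𝒮} in
/-- The universal property of `st_{m|n}(S)`. -/
theorem st.exists_hom (L : LieSuperalgebra.{u, max u v} k)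
    (E : ∀ i j : Fin m ⊕ Fin n, i ≠ j → S →ₗ[k] L.carrier)
    (mem : ∀ i j hij p, ∀ a ∈ 𝒮 p, E i j hij a ∈ L.grading (indexParity i + indexParity j + p))
    (mul : ∀ i j l (hij : i ≠ j) (hjl : j ≠ l) (hil : i ≠ l) p q, ∀ a ∈ 𝒮 p, ∀ b ∈ 𝒮 q,
      L.bracket (E i j hij a) (E j l hjl b) = E i l hil (a * b))
    (zero : ∀ i j l r (hij : i ≠ j) (_ : j ≠ l) (hlr : l ≠ r) (_ : r ≠ i) p q,
      ∀ a ∈ 𝒮 p, ∀ b ∈ 𝒮 q, L.bracket (E i j hij a) (E l r hlr b) = 0) :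
    ∃ φ : (st 𝒮 m n).Hom L, ∀ i j hij a, φ (st.eLin 𝒮 i j hij a) = E i j hij a := by
  let f : StGen 𝒮 m n → L.carrier := fun | .e i j hij _ a => E i j hij a
  have hf : ∀ x, f x ∈ L.grading (StGen.parity x) := fun
    | .e i j hij p a => mem i j hij p a a.2
  have hE : ∀ i j hij p (a : 𝒮 p), Presentation.freeEval L f (stE 𝒮 i j hij a) = E i j hij a :=
    fun i j hij p a => Presentation.freeEval_of L f (.e i j hij p a)
  have hr : ∀ z ∈ {z | StRel 𝒮 m n z}, Presentation.freeEval L f z = 0 := by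
    intro z hz
    cases hz with
    | add => simp [hE]
    | smul => simp [hE]
    | ee i j l hij hjl hil p q a b =>
      simp [hE, Presentation.freeEval_mul, hmul, mul i j l hij hjl hil p q a a.2 b b.2]
    | ee_zero i j l r hij hjl hlr hri p q a b =>
      simp [hE, Presentation.freeEval_mul, zero i j l r hij hjl hlr hri p q a a.2 b b.2]
  let φ : (st 𝒮 m n).Hom L := presented.lift (stRel_homogeneous 𝒮 m n) L f hf hr
  refine ⟨φ, fun i j hij a => ?_⟩
  refine linearMap_eq_of_homogeneous 𝒮
    (f := φ.toLinearMap ∘ₗ st.eLin 𝒮 i j hij)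
    (fun p a ha => ?_) a
  rw [LinearMap.comp_apply, st.eLin_of_mem i j hij ha]
  exact presented.lift_gen _ L f hf hr _

end St

/-! ### The Steinberg periplectic Lie superalgebra -/

section Stp

variable {k : Type u} [CommRing k] {R : Type v} [Ring R] [Algebra k R]
  {ℛ : ZMod 2 → Submodule k R} [GradedAlgebra ℛ] (σ : Superinvolution ℛ) {m : ℕ}

variable (m) in
/-- The projection of the free nonassociative algebra onto `stp_m(R, bar)`. -/
def stp.mk : FreeNonUnitalNonAssocAlgebra k (StpGen ℛ m) →ₗ[k] (stp σ m).carrier :=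
  presented.mk (stpRel_homogeneous σ m)

theorem stp.mk_mul (x y : FreeNonUnitalNonAssocAlgebra k (StpGen ℛ m)) :
    stp.mk σ m (x * y) = (stp σ m).bracket (stp.mk σ m x) (stp.mk σ m y) := rfl

variable {σ} in
theorem stp.mk_eq_zero {z : FreeNonUnitalNonAssocAlgebra k (StpGen ℛ m)} (hz : StpRel σ m z) :
    stp.mk σ m z = 0 :=
  presented.mk_eq_zero (stpRel_homogeneous σ m) hz

/-- The map `a ↦ t_{ij}(a)`, as a linear map. -/
def stp.tLin (i j : Fin m) (hij : i ≠ j) : R →ₗ[k] (stp σ m).carrier :=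
  linearExtension ℛ (fun p a => stp.mk σ m (stpT ℛ i j hij a))
    (fun p a b => by
      have h := stp.mk_eq_zero (StpRel.t_add (σ := σ) i j hij p a b)
      rwa [map_sub, map_sub, sub_sub, sub_eq_zero] at h)
    (fun p c a => by
      have h := stp.mk_eq_zero (StpRel.t_smul (σ := σ) i j hij p c a)
      rwa [map_sub, map_smul, sub_eq_zero] at h)

theorem stp.tLin_of_mem (i j : Fin m) (hij : i ≠ j) {p : ZMod 2} {a : R} (ha : a ∈ ℛ p) :
    stp.tLin σ i j hij a = stp.mk σ m (stpT ℛ i j hij ⟨a, ha⟩) :=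
  linearExtension_of_mem _ _ _ ha

theorem stp.tLin_mem (i j : Fin m) (hij : i ≠ j) {p : ZMod 2} {a : R} (ha : a ∈ ℛ p) :
    stp.tLin σ i j hij a ∈ (stp σ m).grading p := by
  rw [stp.tLin_of_mem σ i j hij ha]
  exact presented.gen_mem (stpRel_homogeneous σ m) (.t i j hij p ⟨a, ha⟩)

/-- The map `a ↦ f_{ij}(a)`, as a linear map. -/
def stp.fLin (i j : Fin m) (hij : i ≠ j) : R →ₗ[k] (stp σ m).carrier :=
  linearExtension ℛ (fun p a => stp.mk σ m (stpF ℛ i j hij a))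
    (fun p a b => by
      have h := stp.mk_eq_zero (StpRel.f_add (σ := σ) i j hij p a b)
      rwa [map_sub, map_sub, sub_sub, sub_eq_zero] at h)
    (fun p c a => by
      have h := stp.mk_eq_zero (StpRel.f_smul (σ := σ) i j hij p c a)
      rwa [map_sub, map_smul, sub_eq_zero] at h)

theorem stp.fLin_of_mem (i j : Fin m) (hij : i ≠ j) {p : ZMod 2} {a : R} (ha : a ∈ ℛ p) :
    stp.fLin σ i j hij a = stp.mk σ m (stpF ℛ i j hij ⟨a, ha⟩) :=
  linearExtension_of_mem _ _ _ ha

theorem stp.fLin_mem (i j : Fin m) (hij : i ≠ j) {p : ZMod 2} {a : R} (ha : a ∈ ℛ p) :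
    stp.fLin σ i j hij a ∈ (stp σ m).grading (p + 1) := by
  rw [stp.fLin_of_mem σ i j hij ha]
  exact presented.gen_mem (stpRel_homogeneous σ m) (.f i j hij p ⟨a, ha⟩)

/-- The map `a ↦ g_{ij}(a)`, as a linear map. -/
def stp.gLin (i j : Fin m) (hij : i ≠ j) : R →ₗ[k] (stp σ m).carrier :=
  linearExtension ℛ (fun p a => stp.mk σ m (stpG ℛ i j hij a))
    (fun p a b => by
      have h := stp.mk_eq_zero (StpRel.g_add (σ := σ) i j hij p a b)
      rwa [map_sub, map_sub, sub_sub, sub_eq_zero] at h)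
    (fun p c a => by
      have h := stp.mk_eq_zero (StpRel.g_smul (σ := σ) i j hij p c a)
      rwa [map_sub, map_smul, sub_eq_zero] at h)

theorem stp.gLin_of_mem (i j : Fin m) (hij : i ≠ j) {p : ZMod 2} {a : R} (ha : a ∈ ℛ p) :
    stp.gLin σ i j hij a = stp.mk σ m (stpG ℛ i j hij ⟨a, ha⟩) :=
  linearExtension_of_mem _ _ _ ha

theorem stp.gLin_mem (i j : Fin m) (hij : i ≠ j) {p : ZMod 2} {a : R} (ha : a ∈ ℛ p) :
    stp.gLin σ i j hij a ∈ (stp σ m).grading (p + 1) := by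
  rw [stp.gLin_of_mem σ i j hij ha]
  exact presented.gen_mem (stpRel_homogeneous σ m) (.g i j hij p ⟨a, ha⟩)

theorem stp.fLin_bar {i j : Fin m} (hij : i ≠ j) (a : R) :
    stp.fLin σ i j hij (σ.bar a) = stp.fLin σ j i hij.symm (rho ℛ a) := by
  refine linearMap_eq_of_homogeneous ℛ (f := stp.fLin σ i j hij ∘ₗ σ.bar)
    (g := stp.fLin σ j i hij.symm ∘ₗ rho ℛ) (fun p a ha => ?_) a
  change stp.fLin σ i j hij (σ.bar a) = stp.fLin σ j i hij.symm (rho ℛ a)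
  rw [stp.fLin_of_mem σ i j hij (σ.bar_mem ha), stp.fLin_of_mem σ j i hij.symm (rho_mem ha),
    ← sub_eq_zero, ← map_sub]
  exact stp.mk_eq_zero (StpRel.f_bar (σ := σ) i j hij p ⟨a, ha⟩)

theorem stp.gLin_bar {i j : Fin m} (hij : i ≠ j) (a : R) :
    stp.gLin σ i j hij (σ.bar a) = -stp.gLin σ j i hij.symm (rho ℛ a) := by
  refine linearMap_eq_of_homogeneous ℛ (f := stp.gLin σ i j hij ∘ₗ σ.bar)
    (g := -(stp.gLin σ j i hij.symm ∘ₗ rho ℛ)) (fun p a ha => ?_) a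
  change stp.gLin σ i j hij (σ.bar a) = -stp.gLin σ j i hij.symm (rho ℛ a)
  rw [stp.gLin_of_mem σ i j hij (σ.bar_mem ha), stp.gLin_of_mem σ j i hij.symm (rho_mem ha),
    eq_neg_iff_add_eq_zero, ← map_add]
  exact stp.mk_eq_zero (StpRel.g_bar (σ := σ) i j hij p ⟨a, ha⟩)

theorem stp.bracket_tLin_tLin {i j l : Fin m} (hij : i ≠ j) (hjl : j ≠ l) (hil : i ≠ l)
    (a b : R) : (stp σ m).bracket (stp.tLin σ i j hij a) (stp.tLin σ j l hjl b) =
      stp.tLin σ i l hil (a * b) := by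
  refine bilinear_eq_of_homogeneous ℛ ℛ
    (f := (stp σ m).bracket.compl₁₂ (stp.tLin σ i j hij) (stp.tLin σ j l hjl))
    (g := (LinearMap.mul k R).compr₂ (stp.tLin σ i l hil)) (fun p q a ha b hb => ?_) a b
  change (stp σ m).bracket (stp.tLin σ i j hij a) (stp.tLin σ j l hjl b) =
      stp.tLin σ i l hil (a * b)
  rw [stp.tLin_of_mem σ i j hij ha, stp.tLin_of_mem σ j l hjl hb,
    stp.tLin_of_mem σ i l hil (SetLike.mul_mem_graded ha hb), ← sub_eq_zero, ← stp.mk_mul,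
    ← map_sub]
  exact stp.mk_eq_zero (StpRel.tt (σ := σ) i j l hij hjl hil p q ⟨a, ha⟩ ⟨b, hb⟩)

theorem stp.bracket_tLin_fLin {i j l : Fin m} (hij : i ≠ j) (hjl : j ≠ l) (hil : i ≠ l)
    (a b : R) : (stp σ m).bracket (stp.tLin σ i j hij a) (stp.fLin σ j l hjl b) =
      stp.fLin σ i l hil (a * b) := by
  refine bilinear_eq_of_homogeneous ℛ ℛ
    (f := (stp σ m).bracket.compl₁₂ (stp.tLin σ i j hij) (stp.fLin σ j l hjl))
    (g := (LinearMap.mul k R).compr₂ (stp.fLin σ i l hil)) (fun p q a ha b hb => ?_) a b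
  change (stp σ m).bracket (stp.tLin σ i j hij a) (stp.fLin σ j l hjl b) =
      stp.fLin σ i l hil (a * b)
  rw [stp.tLin_of_mem σ i j hij ha, stp.fLin_of_mem σ j l hjl hb,
    stp.fLin_of_mem σ i l hil (SetLike.mul_mem_graded ha hb), ← sub_eq_zero, ← stp.mk_mul,
    ← map_sub]
  exact stp.mk_eq_zero (StpRel.tf (σ := σ) i j l hij hjl hil p q ⟨a, ha⟩ ⟨b, hb⟩)

theorem stp.bracket_gLin_tLin {i j l : Fin m} (hij : i ≠ j) (hjl : j ≠ l) (hil : i ≠ l)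
    (a b : R) : (stp σ m).bracket (stp.gLin σ i j hij a) (stp.tLin σ j l hjl b) =
      stp.gLin σ i l hil (a * b) := by
  refine bilinear_eq_of_homogeneous ℛ ℛ
    (f := (stp σ m).bracket.compl₁₂ (stp.gLin σ i j hij) (stp.tLin σ j l hjl))
    (g := (LinearMap.mul k R).compr₂ (stp.gLin σ i l hil)) (fun p q a ha b hb => ?_) a b
  change (stp σ m).bracket (stp.gLin σ i j hij a) (stp.tLin σ j l hjl b) =
      stp.gLin σ i l hil (a * b)
  rw [stp.gLin_of_mem σ i j hij ha, stp.tLin_of_mem σ j l hjl hb,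
    stp.gLin_of_mem σ i l hil (SetLike.mul_mem_graded ha hb), ← sub_eq_zero, ← stp.mk_mul,
    ← map_sub]
  exact stp.mk_eq_zero (StpRel.gt (σ := σ) i j l hij hjl hil p q ⟨a, ha⟩ ⟨b, hb⟩)

theorem stp.bracket_fLin_gLin {i j l : Fin m} (hij : i ≠ j) (hjl : j ≠ l) (hil : i ≠ l)
    (a b : R) : (stp σ m).bracket (stp.fLin σ i j hij a) (stp.gLin σ j l hjl b) =
      stp.tLin σ i l hil (a * b) := by
  refine bilinear_eq_of_homogeneous ℛ ℛ
    (f := (stp σ m).bracket.compl₁₂ (stp.fLin σ i j hij) (stp.gLin σ j l hjl))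
    (g := (LinearMap.mul k R).compr₂ (stp.tLin σ i l hil)) (fun p q a ha b hb => ?_) a b
  change (stp σ m).bracket (stp.fLin σ i j hij a) (stp.gLin σ j l hjl b) =
      stp.tLin σ i l hil (a * b)
  rw [stp.fLin_of_mem σ i j hij ha, stp.gLin_of_mem σ j l hjl hb,
    stp.tLin_of_mem σ i l hil (SetLike.mul_mem_graded ha hb), ← sub_eq_zero, ← stp.mk_mul,
    ← map_sub]
  exact stp.mk_eq_zero (StpRel.fg (σ := σ) i j l hij hjl hil p q ⟨a, ha⟩ ⟨b, hb⟩)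

theorem stp.bracket_tLin_tLin_zero {i j l r : Fin m}
    (hij : i ≠ j) (hjl : j ≠ l) (hlr : l ≠ r) (hri : r ≠ i)
    (a b : R) : (stp σ m).bracket (stp.tLin σ i j hij a) (stp.tLin σ l r hlr b) = 0 := by
  refine bilinear_eq_of_homogeneous ℛ ℛ
    (f := (stp σ m).bracket.compl₁₂ (stp.tLin σ i j hij) (stp.tLin σ l r hlr))
    (g := 0) (fun p q a ha b hb => ?_) a b
  change (stp σ m).bracket (stp.tLin σ i j hij a) (stp.tLin σ l r hlr b) = 0
  rw [stp.tLin_of_mem σ i j hij ha, stp.tLin_of_mem σ l r hlr hb, ← stp.mk_mul]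
  exact stp.mk_eq_zero (StpRel.tt_zero (σ := σ) i j l r hij hjl hlr hri p q ⟨a, ha⟩ ⟨b, hb⟩)

theorem stp.bracket_tLin_fLin_zero {i j l r : Fin m}
    (hij : i ≠ j) (hjl : j ≠ l) (hlr : l ≠ r) (hrj : r ≠ j)
    (a b : R) : (stp σ m).bracket (stp.tLin σ i j hij a) (stp.fLin σ l r hlr b) = 0 := by
  refine bilinear_eq_of_homogeneous ℛ ℛ
    (f := (stp σ m).bracket.compl₁₂ (stp.tLin σ i j hij) (stp.fLin σ l r hlr))
    (g := 0) (fun p q a ha b hb => ?_) a b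
  change (stp σ m).bracket (stp.tLin σ i j hij a) (stp.fLin σ l r hlr b) = 0
  rw [stp.tLin_of_mem σ i j hij ha, stp.fLin_of_mem σ l r hlr hb, ← stp.mk_mul]
  exact stp.mk_eq_zero (StpRel.tf_zero (σ := σ) i j l r hij hjl hlr hrj p q ⟨a, ha⟩ ⟨b, hb⟩)

theorem stp.bracket_gLin_tLin_zero {i j l r : Fin m}
    (hij : i ≠ j) (hlj : l ≠ j) (hlr : l ≠ r) (hil : i ≠ l)
    (a b : R) : (stp σ m).bracket (stp.gLin σ i j hij a) (stp.tLin σ l r hlr b) = 0 := by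
  refine bilinear_eq_of_homogeneous ℛ ℛ
    (f := (stp σ m).bracket.compl₁₂ (stp.gLin σ i j hij) (stp.tLin σ l r hlr))
    (g := 0) (fun p q a ha b hb => ?_) a b
  change (stp σ m).bracket (stp.gLin σ i j hij a) (stp.tLin σ l r hlr b) = 0
  rw [stp.gLin_of_mem σ i j hij ha, stp.tLin_of_mem σ l r hlr hb, ← stp.mk_mul]
  exact stp.mk_eq_zero (StpRel.gt_zero (σ := σ) i j l r hij hlj hlr hil p q ⟨a, ha⟩ ⟨b, hb⟩)

theorem stp.bracket_fLin_fLin_zero {i j l r : Fin m}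
    (hij : i ≠ j) (hlr : l ≠ r)
    (a b : R) : (stp σ m).bracket (stp.fLin σ i j hij a) (stp.fLin σ l r hlr b) = 0 := by
  refine bilinear_eq_of_homogeneous ℛ ℛ
    (f := (stp σ m).bracket.compl₁₂ (stp.fLin σ i j hij) (stp.fLin σ l r hlr))
    (g := 0) (fun p q a ha b hb => ?_) a b
  change (stp σ m).bracket (stp.fLin σ i j hij a) (stp.fLin σ l r hlr b) = 0
  rw [stp.fLin_of_mem σ i j hij ha, stp.fLin_of_mem σ l r hlr hb, ← stp.mk_mul]
  exact stp.mk_eq_zero (StpRel.ff_zero (σ := σ) i j l r hij hlr p q ⟨a, ha⟩ ⟨b, hb⟩)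

theorem stp.bracket_gLin_gLin_zero {i j l r : Fin m}
    (hij : i ≠ j) (hlr : l ≠ r)
    (a b : R) : (stp σ m).bracket (stp.gLin σ i j hij a) (stp.gLin σ l r hlr b) = 0 := by
  refine bilinear_eq_of_homogeneous ℛ ℛ
    (f := (stp σ m).bracket.compl₁₂ (stp.gLin σ i j hij) (stp.gLin σ l r hlr))
    (g := 0) (fun p q a ha b hb => ?_) a b
  change (stp σ m).bracket (stp.gLin σ i j hij a) (stp.gLin σ l r hlr b) = 0
  rw [stp.gLin_of_mem σ i j hij ha, stp.gLin_of_mem σ l r hlr hb, ← stp.mk_mul]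
  exact stp.mk_eq_zero (StpRel.gg_zero (σ := σ) i j l r hij hlr p q ⟨a, ha⟩ ⟨b, hb⟩)

theorem stp.bracket_fLin_gLin_zero {i j l r : Fin m}
    (hij : i ≠ j) (hil : i ≠ l) (hir : i ≠ r) (hjl : j ≠ l)
    (hjr : j ≠ r) (hlr : l ≠ r)
    (a b : R) : (stp σ m).bracket (stp.fLin σ i j hij a) (stp.gLin σ l r hlr b) = 0 := by
  refine bilinear_eq_of_homogeneous ℛ ℛ
    (f := (stp σ m).bracket.compl₁₂ (stp.fLin σ i j hij) (stp.gLin σ l r hlr))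
    (g := 0) (fun p q a ha b hb => ?_) a b
  change (stp σ m).bracket (stp.fLin σ i j hij a) (stp.gLin σ l r hlr b) = 0
  rw [stp.fLin_of_mem σ i j hij ha, stp.gLin_of_mem σ l r hlr hb, ← stp.mk_mul]
  exact stp.mk_eq_zero (StpRel.fg_zero (σ := σ) i j l r hij hil hir hjl hjr hlr p q ⟨a, ha⟩ ⟨b, hb⟩)

/-- The universal property of `stp_m(R, bar)`. -/
theorem stp.exists_hom (L : LieSuperalgebra.{u, max u v} k)
    (T F G : ∀ i j : Fin m, i ≠ j → R →ₗ[k] L.carrier)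
    (T_mem : ∀ i j hij p, ∀ a ∈ ℛ p, T i j hij a ∈ L.grading p)
    (F_mem : ∀ i j hij p, ∀ a ∈ ℛ p, F i j hij a ∈ L.grading (p + 1))
    (G_mem : ∀ i j hij p, ∀ a ∈ ℛ p, G i j hij a ∈ L.grading (p + 1))
    (F_bar : ∀ i j hij a, F i j hij (σ.bar a) = F j i hij.symm (rho ℛ a))
    (G_bar : ∀ i j hij a, G i j hij (σ.bar a) = -G j i hij.symm (rho ℛ a))
    (TT : ∀ i j l (hij : i ≠ j) (hjl : j ≠ l) (hil : i ≠ l) p q, ∀ a ∈ ℛ p, ∀ b ∈ ℛ q,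
      L.bracket (T i j hij a) (T j l hjl b) = T i l hil (a * b))
    (TF : ∀ i j l (hij : i ≠ j) (hjl : j ≠ l) (hil : i ≠ l) p q, ∀ a ∈ ℛ p, ∀ b ∈ ℛ q,
      L.bracket (T i j hij a) (F j l hjl b) = F i l hil (a * b))
    (GT : ∀ i j l (hij : i ≠ j) (hjl : j ≠ l) (hil : i ≠ l) p q, ∀ a ∈ ℛ p, ∀ b ∈ ℛ q,
      L.bracket (G i j hij a) (T j l hjl b) = G i l hil (a * b))
    (FG : ∀ i j l (hij : i ≠ j) (hjl : j ≠ l) (hil : i ≠ l) p q, ∀ a ∈ ℛ p, ∀ b ∈ ℛ q,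
      L.bracket (F i j hij a) (G j l hjl b) = T i l hil (a * b))
    (TT_zero : ∀ i j l r (hij : i ≠ j) (_ : j ≠ l) (hlr : l ≠ r) (_ : r ≠ i),
      ∀ p q, ∀ a ∈ ℛ p, ∀ b ∈ ℛ q, L.bracket (T i j hij a) (T l r hlr b) = 0)
    (TF_zero : ∀ i j l r (hij : i ≠ j) (_ : j ≠ l) (hlr : l ≠ r) (_ : r ≠ j),
      ∀ p q, ∀ a ∈ ℛ p, ∀ b ∈ ℛ q, L.bracket (T i j hij a) (F l r hlr b) = 0)
    (GT_zero : ∀ i j l r (hij : i ≠ j) (_ : l ≠ j) (hlr : l ≠ r) (_ : i ≠ l),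
      ∀ p q, ∀ a ∈ ℛ p, ∀ b ∈ ℛ q, L.bracket (G i j hij a) (T l r hlr b) = 0)
    (FF_zero : ∀ i j l r (hij : i ≠ j) (hlr : l ≠ r),
      ∀ p q, ∀ a ∈ ℛ p, ∀ b ∈ ℛ q, L.bracket (F i j hij a) (F l r hlr b) = 0)
    (GG_zero : ∀ i j l r (hij : i ≠ j) (hlr : l ≠ r),
      ∀ p q, ∀ a ∈ ℛ p, ∀ b ∈ ℛ q, L.bracket (G i j hij a) (G l r hlr b) = 0)
    (FG_zero : ∀ i j l r (hij : i ≠ j) (_ : i ≠ l) (_ : i ≠ r) (_ : j ≠ l) (_ : j ≠ r) (hlr : l ≠ r),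
      ∀ p q, ∀ a ∈ ℛ p, ∀ b ∈ ℛ q, L.bracket (F i j hij a) (G l r hlr b) = 0) :
    ∃ ψ : (stp σ m).Hom L, ∀ i j hij a, ψ (stp.tLin σ i j hij a) = T i j hij a ∧
      ψ (stp.fLin σ i j hij a) = F i j hij a ∧ ψ (stp.gLin σ i j hij a) = G i j hij a := by
  let e : StpGen ℛ m → L.carrier := fun
    | .t i j hij _ a => T i j hij a
    | .f i j hij _ a => F i j hij a
    | .g i j hij _ a => G i j hij a
  have he : ∀ x, e x ∈ L.grading (StpGen.parity x) := fun
    | .t i j hij p a => T_mem i j hij p a a.2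
    | .f i j hij p a => F_mem i j hij p a a.2
    | .g i j hij p a => G_mem i j hij p a a.2
  have hT : ∀ i j hij p (a : ℛ p), Presentation.freeEval L e (stpT ℛ i j hij a) = T i j hij a :=
    fun i j hij p a => Presentation.freeEval_of L e (.t i j hij p a)
  have hF : ∀ i j hij p (a : ℛ p), Presentation.freeEval L e (stpF ℛ i j hij a) = F i j hij a :=
    fun i j hij p a => Presentation.freeEval_of L e (.f i j hij p a)
  have hG : ∀ i j hij p (a : ℛ p), Presentation.freeEval L e (stpG ℛ i j hij a) = G i j hij a :=
    fun i j hij p a => Presentation.freeEval_of L e (.g i j hij p a)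
  have hr : ∀ z ∈ {z | StpRel σ m z}, Presentation.freeEval L e z = 0 := by
    intro z hz
    cases hz with
    | t_add => simp [hT]
    | t_smul => simp [hT]
    | f_add => simp [hF]
    | f_smul => simp [hF]
    | g_add => simp [hG]
    | g_smul => simp [hG]
    | f_bar i j hij p a => simp [hF, hbar, hrho, F_bar]
    | g_bar i j hij p a => simp [hG, hbar, hrho, G_bar]
    | tt i j l hij hjl hil p q a b =>
      simp [hT, Presentation.freeEval_mul, hmul,
        TT i j l hij hjl hil p q a a.2 b b.2]
    | tf i j l hij hjl hil p q a b =>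
      simp [hT, hF, Presentation.freeEval_mul, hmul,
        TF i j l hij hjl hil p q a a.2 b b.2]
    | gt i j l hij hjl hil p q a b =>
      simp [hT, hG, Presentation.freeEval_mul, hmul,
        GT i j l hij hjl hil p q a a.2 b b.2]
    | fg i j l hij hjl hil p q a b =>
      simp [hT, hF, hG, Presentation.freeEval_mul, hmul,
        FG i j l hij hjl hil p q a a.2 b b.2]
    | tt_zero i j l r hij hjl hlr hri p q a b =>
      simp [hT, Presentation.freeEval_mul,
        TT_zero i j l r hij hjl hlr hri p q a a.2 b b.2]
    | tf_zero i j l r hij hjl hlr hrj p q a b =>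
      simp [hT, hF, Presentation.freeEval_mul,
        TF_zero i j l r hij hjl hlr hrj p q a a.2 b b.2]
    | gt_zero i j l r hij hlj hlr hil p q a b =>
      simp [hT, hG, Presentation.freeEval_mul,
        GT_zero i j l r hij hlj hlr hil p q a a.2 b b.2]
    | ff_zero i j l r hij hlr p q a b =>
      simp [hF, Presentation.freeEval_mul,
        FF_zero i j l r hij hlr p q a a.2 b b.2]
    | gg_zero i j l r hij hlr p q a b =>
      simp [hG, Presentation.freeEval_mul,
        GG_zero i j l r hij hlr p q a a.2 b b.2]
    | fg_zero i j l r hij hil hir hjl hjr hlr p q a b =>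
      simp [hF, hG, Presentation.freeEval_mul,
        FG_zero i j l r hij hil hir hjl hjr hlr p q a a.2 b b.2]
  let ψ : (stp σ m).Hom L := presented.lift (stpRel_homogeneous σ m) L e he hr
  refine ⟨ψ, fun i j hij a => ⟨?_, ?_, ?_⟩⟩
  · refine linearMap_eq_of_homogeneous ℛ (f := ψ.toLinearMap ∘ₗ stp.tLin σ i j hij)
      (fun p a ha => ?_) a
    rw [LinearMap.comp_apply, stp.tLin_of_mem σ i j hij ha]
    exact presented.lift_gen _ L e he hr _
  · refine linearMap_eq_of_homogeneous ℛ (f := ψ.toLinearMap ∘ₗ stp.fLin σ i j hij)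
      (fun p a ha => ?_) a
    rw [LinearMap.comp_apply, stp.fLin_of_mem σ i j hij ha]
    exact presented.lift_gen _ L e he hr _
  · refine linearMap_eq_of_homogeneous ℛ (f := ψ.toLinearMap ∘ₗ stp.gLin σ i j hij)
      (fun p a ha => ?_) a
    rw [LinearMap.comp_apply, stp.gLin_of_mem σ i j hij ha]
    exact presented.lift_gen _ L e he hr _

end Stp

/-! ### Families of root vectors -/

section RootFamily

/-- This is where `3 ≤ m` is used; every choice of an auxiliary index rests on it. -/
theorem exists_fin_ne_ne {m : ℕ} (hm : 3 ≤ m) (i j : Fin m) : ∃ l : Fin m, l ≠ i ∧ l ≠ j := by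
  have h : ({i, j} : Finset (Fin m)).card < (Finset.univ : Finset (Fin m)).card := by
    have := Finset.card_le_two (a := i) (b := j)
    rw [Finset.card_univ, Fintype.card_fin]
    omega
  obtain ⟨l, _, hl⟩ := Finset.exists_mem_notMem_of_card_lt_card h
  simp only [Finset.mem_insert, Finset.mem_singleton, not_or] at hl
  exact ⟨l, hl⟩

/-- The index in `{1, …, m}` underlying a row or column index of an `(m|m)`-matrix. -/
def baseIndex {m : ℕ} : Fin m ⊕ Fin m → Fin m := Sum.elim id id

@[simp] theorem baseIndex_swap {m : ℕ} (x : Fin m ⊕ Fin m) : baseIndex x.swap = baseIndex x := by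
  cases x <;> rfl

@[simp] theorem baseIndex_inl {m : ℕ} (i : Fin m) : baseIndex (.inl i : Fin m ⊕ Fin m) = i := rfl

@[simp] theorem baseIndex_inr {m : ℕ} (i : Fin m) : baseIndex (.inr i : Fin m ⊕ Fin m) = i := rfl

theorem ne_of_baseIndex_ne {m : ℕ} {x y : Fin m ⊕ Fin m} (h : baseIndex x ≠ baseIndex y) :
    x ≠ y :=
  fun e => h (congrArg baseIndex e)

theorem eq_swap {m : ℕ} {x y : Fin m ⊕ Fin m} (h : baseIndex x = baseIndex y) (hxy : x ≠ y) :
    y = x.swap := by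
  cases x <;> cases y <;> simp_all

theorem swap_ne {m : ℕ} (x : Fin m ⊕ Fin m) : x ≠ x.swap := by
  cases x <;> simp

theorem exists_baseIndex_ne_ne {m : ℕ} (hm : 3 ≤ m) (x y : Fin m ⊕ Fin m) :
    ∃ z : Fin m ⊕ Fin m, baseIndex x ≠ baseIndex z ∧ baseIndex y ≠ baseIndex z := by
  obtain ⟨l, h₁, h₂⟩ := exists_fin_ne_ne hm (baseIndex x) (baseIndex y)
  exact ⟨.inl l, h₁.symm, h₂.symm⟩

variable {k : Type u} [CommRing k] {S : Type v} [Ring S] [Algebra k S]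
  {𝒮 : ZMod 2 → Submodule k S} {m : ℕ} {L : LieSuperalgebra k}

variable (𝒮 L) in
/-- The relations of `st_{m|m}(S)` that only involve the elements `e_{xy}(a)` for indices `x` and
`y` with distinct underlying indices in `{1, …, m}`. -/
structure IsRootFamily (u : Fin m ⊕ Fin m → Fin m ⊕ Fin m → S →ₗ[k] L.carrier) : Prop where
  mem : ∀ {x y}, baseIndex x ≠ baseIndex y → ∀ {p a}, a ∈ 𝒮 p →
    u x y a ∈ L.grading (indexParity x + indexParity y + p)
  mul : ∀ {x y z}, baseIndex x ≠ baseIndex y → baseIndex y ≠ baseIndex z →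
    baseIndex x ≠ baseIndex z → ∀ a b, L.bracket (u x y a) (u y z b) = u x z (a * b)
  zero : ∀ {x y z w}, baseIndex x ≠ baseIndex y → baseIndex z ≠ baseIndex w → y ≠ z → w ≠ x →
    ∀ a b, L.bracket (u x y a) (u z w b) = 0

variable [GradedAlgebra 𝒮] {u : Fin m ⊕ Fin m → Fin m ⊕ Fin m → S →ₗ[k] L.carrier}
  {x y z w : Fin m ⊕ Fin m} {p q : ZMod 2} {a b : S}

namespace IsRootFamily

/-- Expand `u z x.swap (a * b)` as a bracket through `y` and reassociate: the two outer factors `u x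
z 1` and `u y x.swap b` commute, so the inner product `u x z 1`, `u z y a` can be formed first and
gives `u x y a`. -/
theorem bracket_loop_eq (hu : IsRootFamily 𝒮 L u) (hxy : baseIndex x ≠ baseIndex y)
    (hxz : baseIndex x ≠ baseIndex z) (hyz : baseIndex y ≠ baseIndex z) (a b : S) :
    L.bracket (u x y a) (u y x.swap b) = L.bracket (u x z 1) (u z x.swap (a * b)) := by
  have hx : baseIndex x = baseIndex x.swap := (baseIndex_swap x).symm
  -- Reassociating needs homogeneous first and second factors; `b` sits in the last one and may stay
  -- arbitrary.
  refine linearMap_eq_of_homogeneous 𝒮 (f := L.bracket.flip (u y x.swap b) ∘ₗ u x y)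
    (g := L.bracket (u x z 1) ∘ₗ u z x.swap ∘ₗ LinearMap.mulRight k b) (fun p a ha => ?_) a
  change L.bracket (u x y a) (u y x.swap b) = L.bracket (u x z 1) (u z x.swap (a * b))
  rw [← hu.mul hyz.symm (hx ▸ hxy.symm) (hx ▸ hxz.symm),
    ← L.bracket_assoc (hu.mem hxz (SetLike.one_mem_graded 𝒮)) (hu.mem hyz.symm ha),
    hu.mul hxz hyz.symm hxy, one_mul]
  exact hu.zero hxz (hx ▸ hxy.symm) (ne_of_baseIndex_ne hyz.symm) (swap_ne x).symm _ _

/-- An index of a row or column whose underlying index is not that of `x`. -/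
def otherIndex (hm : 3 ≤ m) (x : Fin m ⊕ Fin m) : Fin m ⊕ Fin m :=
  (exists_baseIndex_ne_ne hm x x).choose

theorem baseIndex_ne_otherIndex (hm : 3 ≤ m) (x : Fin m ⊕ Fin m) :
    baseIndex x ≠ baseIndex (otherIndex hm x) :=
  (exists_baseIndex_ne_ne hm x x).choose_spec.1

variable (u) in
/-- The element `e_{xy}(a)`, for `y` the index different from `x` with the same underlying index. -/
def loop (hm : 3 ≤ m) (x : Fin m ⊕ Fin m) : S →ₗ[k] L.carrier :=
  L.bracket (u x (otherIndex hm x) 1) ∘ₗ u (otherIndex hm x) x.swap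

/-- Independence of the auxiliary index: this makes `loop` well defined, and it is also the product
relation of `st` at a position whose two indices have the same base. -/
theorem bracket_eq_loop (hu : IsRootFamily 𝒮 L u) (hm : 3 ≤ m)
    (hxy : baseIndex x ≠ baseIndex y) (a b : S) :
    L.bracket (u x y a) (u y x.swap b) = loop u hm x (a * b) := by
  have hw := baseIndex_ne_otherIndex hm x
  change _ = L.bracket (u x (otherIndex hm x) 1) (u (otherIndex hm x) x.swap (a * b))
  by_cases h : baseIndex y = baseIndex (otherIndex hm x)
  -- If `y` has the base of the chosen index, the two cannot be compared directly; a third base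
  -- serves as an intermediate stop.
  · obtain ⟨z, hxz, hyz⟩ := exists_baseIndex_ne_ne hm x y
    rw [hu.bracket_loop_eq hxy hxz hyz, hu.bracket_loop_eq hxz hw (h ▸ hyz.symm), one_mul]
  · exact hu.bracket_loop_eq hxy hw h a b

theorem loop_eq (hu : IsRootFamily 𝒮 L u) (hm : 3 ≤ m) (hxy : baseIndex x ≠ baseIndex y) (a : S) :
    loop u hm x a = L.bracket (u x y a) (u y x.swap 1) := by
  rw [hu.bracket_eq_loop hm hxy, mul_one]

theorem loop_mem (hu : IsRootFamily 𝒮 L u) (hm : 3 ≤ m) (ha : a ∈ 𝒮 p) :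
    loop u hm x a ∈ L.grading (indexParity x + indexParity x.swap + p) := by
  have hw := baseIndex_ne_otherIndex hm x
  rw [hu.loop_eq hm hw]
  convert L.bracket_mem (hu.mem hw ha)
    (hu.mem ((baseIndex_swap x).symm ▸ hw.symm) (SetLike.one_mem_graded 𝒮)) using 2
  -- The parity of the auxiliary index is counted twice and cancels.
  linear_combination -CharTwo.add_self_eq_zero (indexParity (otherIndex hm x))

/-- With an auxiliary index whose base differs from those of both `x` and `z`, the loop becomes a
bracket of two root vectors. The outer factors `u x y a` and `u x.swap z b` commute, so the triple
bracket can be evaluated from the right. -/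
theorem bracket_loop_left (hu : IsRootFamily 𝒮 L u) (hm : 3 ≤ m)
    (hxz : baseIndex x ≠ baseIndex z) (ha : a ∈ 𝒮 p) (b : S) :
    L.bracket (loop u hm x a) (u x.swap z b) = u x z (a * b) := by
  obtain ⟨y, hxy, hzy⟩ := exists_baseIndex_ne_ne hm x z
  have hx : baseIndex x = baseIndex x.swap := (baseIndex_swap x).symm
  rw [hu.loop_eq hm hxy, L.bracket_assoc (hu.mem hxy ha)
    (hu.mem (hx ▸ hxy.symm) (SetLike.one_mem_graded 𝒮)), hu.mul (hx ▸ hxy.symm) (hx ▸ hxz) hzy.symm,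
    hu.mul hxy hzy.symm hxz, one_mul]
  exact hu.zero hxy (hx ▸ hxz) (ne_of_baseIndex_ne (hx ▸ hxy.symm)) (ne_of_baseIndex_ne hxz.symm) _ _

/-- The mirror image of `bracket_loop_left`, evaluated from the left. Here `b` lies in a middle
factor, so it has to be homogeneous as well. -/
theorem bracket_loop_right (hu : IsRootFamily 𝒮 L u) (hm : 3 ≤ m)
    (hxz : baseIndex x ≠ baseIndex z) (ha : a ∈ 𝒮 p) (hb : b ∈ 𝒮 q) :
    L.bracket (u x z a) (loop u hm z b) = u x z.swap (a * b) := by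
  obtain ⟨y, hxy, hzy⟩ := exists_baseIndex_ne_ne hm x z
  have hz : baseIndex z = baseIndex z.swap := (baseIndex_swap z).symm
  rw [hu.loop_eq hm hzy, ← L.bracket_assoc (hu.mem hxz ha) (hu.mem hzy hb), hu.mul hxz hzy hxy,
    hu.mul hxy (hz ▸ hzy.symm) (hz ▸ hxz), mul_one]
  exact hu.zero hxz (hz ▸ hzy.symm) (ne_of_baseIndex_ne hzy)
    (ne_of_baseIndex_ne (hz ▸ hxz.symm)) _ _

/-- The auxiliary index of the loop can be chosen so that `u z w b` annihilates both factors. For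
this it only has to differ from `z` and `w` as an index; its base may agree with one of theirs. -/
theorem bracket_loop_eq_zero (hu : IsRootFamily 𝒮 L u) (hm : 3 ≤ m)
    (hzw : baseIndex z ≠ baseIndex w) (hz : z ≠ x.swap) (hw : w ≠ x) (ha : a ∈ 𝒮 p)
    (hb : b ∈ 𝒮 q) : L.bracket (u z w b) (loop u hm x a) = 0 := by
  obtain ⟨y, hxy, hyz, hyw⟩ : ∃ y, baseIndex x ≠ baseIndex y ∧ y ≠ z ∧ y ≠ w := by
    obtain ⟨y, hxy, -⟩ := exists_baseIndex_ne_ne hm x x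
    -- If `y` is one of `z`, `w`, then its partner `y.swap` is neither: it differs from `y`, and it
    -- cannot be the other one because `z` and `w` have different bases.
    by_cases h : y = z ∨ y = w
    · refine ⟨y.swap, by rwa [baseIndex_swap], ?_, ?_⟩ <;> rintro rfl <;>
        rcases h with h | h <;>
        first
        | exact swap_ne y h.symm
        | exact swap_ne y h
        | (rw [← h, baseIndex_swap] at hzw; exact hzw rfl)
    · rw [not_or] at h
      exact ⟨y, hxy, h.1, h.2⟩
  have hx : baseIndex x = baseIndex x.swap := (baseIndex_swap x).symm
  rw [hu.loop_eq hm hxy]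
  exact L.bracket_bracket_eq_zero (hu.mem hzw hb) (hu.mem hxy ha)
    (hu.zero hzw hxy hw hyz _ _) (hu.zero hzw (hx ▸ hxy.symm) hyw.symm hz.symm _ _)

/-- Write the second loop as a bracket through a base different from both; the first loop commutes
with each factor by `bracket_loop_eq_zero`. The case `z = x` is included, and `z = x.swap` is the
one pair on which `st` imposes no relation. -/
theorem bracket_loop_loop (hu : IsRootFamily 𝒮 L u) (hm : 3 ≤ m) (hz : z ≠ x.swap)
    (ha : a ∈ 𝒮 p) (hb : b ∈ 𝒮 q) : L.bracket (loop u hm x a) (loop u hm z b) = 0 := by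
  obtain ⟨y, hxy, hzy⟩ := exists_baseIndex_ne_ne hm x z
  have hx : baseIndex x = baseIndex x.swap := (baseIndex_swap x).symm
  have hz' : baseIndex z = baseIndex z.swap := (baseIndex_swap z).symm
  have hzx : z.swap ≠ x := fun h => hz (by rw [← h, Sum.swap_swap])
  have h1 := SetLike.one_mem_graded 𝒮
  rw [hu.loop_eq hm hzy]
  refine L.bracket_bracket_eq_zero (hu.loop_mem hm ha) (hu.mem hzy hb) ?_ ?_
  · exact L.bracket_eq_zero_symm (hu.mem hzy hb) (hu.loop_mem hm ha)
      (hu.bracket_loop_eq_zero hm hzy hz (ne_of_baseIndex_ne hxy.symm) ha hb)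
  · exact L.bracket_eq_zero_symm (hu.mem (hz' ▸ hzy.symm) h1) (hu.loop_mem hm ha)
      (hu.bracket_loop_eq_zero hm (hz' ▸ hzy.symm) (ne_of_baseIndex_ne (hx ▸ hxy.symm)) hzx ha h1)

open Classical in
/-- A family of root vectors extends to a homomorphism from `st_{m|m}(S)`. -/
theorem exists_hom {L : LieSuperalgebra.{u, max u v} k}
    {u : Fin m ⊕ Fin m → Fin m ⊕ Fin m → S →ₗ[k] L.carrier}
    (hu : IsRootFamily 𝒮 L u) (hm : 3 ≤ m) :
    ∃ φ : (st 𝒮 m m).Hom L,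
      (∀ x y hxy a, baseIndex x ≠ baseIndex y → φ (st.eLin 𝒮 x y hxy a) = u x y a) ∧
      ∀ x y z (hxy : x ≠ y) a b, baseIndex x = baseIndex y → baseIndex x ≠ baseIndex z →
        φ (st.eLin 𝒮 x y hxy (a * b)) = L.bracket (u x z a) (u z y b) := by
  -- For distinct `x`, `y` of equal base, `y` is forced to be `x.swap`, so the loop needs only `x`.
  let E : ∀ x y : Fin m ⊕ Fin m, x ≠ y → S →ₗ[k] L.carrier := fun x y _ =>
    if baseIndex x = baseIndex y then loop u hm x else u x y
  suffices h : ∃ φ : (st 𝒮 m m).Hom L, ∀ x y hxy a, φ (st.eLin 𝒮 x y hxy a) = E x y hxy a by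
    obtain ⟨φ, hφ⟩ := h
    refine ⟨φ, fun x y hxy a h => ?_, fun x y z hxy a b h hz => ?_⟩
    · rw [hφ]
      simp only [E, if_neg h]
    · obtain rfl := eq_swap h hxy
      rw [hφ, hu.bracket_eq_loop hm hz]
      simp only [E, if_pos h]
  refine st.exists_hom L E (fun x y hxy p a ha => ?_)
    (fun x y z hxy hyz hxz p q a ha b hb => ?_)
    (fun x y z w hxy hyz hzw hwx p q a ha b hb => ?_)
  · by_cases h : baseIndex x = baseIndex y
    · obtain rfl := eq_swap h hxy
      simp only [E, if_pos h]
      exact hu.loop_mem hm ha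
    · simp only [E, if_neg h]
      exact hu.mem h ha
  -- Each base carries only two indices, so among three distinct indices at most one pair shares a
  -- base. Hence at most one of the three elements in the product relation is a loop.
  · by_cases hxy' : baseIndex x = baseIndex y
    · obtain rfl := eq_swap hxy' hxy
      have hyz' : baseIndex x.swap ≠ baseIndex z := fun h =>
        hxz (by rw [eq_swap h hyz, Sum.swap_swap])
      have hxz' : baseIndex x ≠ baseIndex z := hxy' ▸ hyz'
      simp only [E, if_pos hxy', if_neg hyz', if_neg hxz']
      exact hu.bracket_loop_left hm hxz' ha b
    · by_cases hyz' : baseIndex y = baseIndex z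
      · obtain rfl := eq_swap hyz' hyz
        have hxz' : baseIndex x ≠ baseIndex y.swap := hyz' ▸ hxy'
        simp only [E, if_neg hxy', if_pos hyz', if_neg hxz']
        exact hu.bracket_loop_right hm hxy' ha hb
      · by_cases hxz' : baseIndex x = baseIndex z
        · obtain rfl := eq_swap hxz' hxz
          simp only [E, if_neg hxy', if_neg hyz', if_pos hxz']
          exact hu.bracket_eq_loop hm hxy' a b
        · simp only [E, if_neg hxy', if_neg hyz', if_neg hxz']
          exact hu.mul hxy' hyz' hxz' a b
  · by_cases hxy' : baseIndex x = baseIndex y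
    · obtain rfl := eq_swap hxy' hxy
      by_cases hzw' : baseIndex z = baseIndex w
      · obtain rfl := eq_swap hzw' hzw
        simp only [E, if_pos hxy', if_pos hzw']
        exact hu.bracket_loop_loop hm hyz.symm ha hb
      · simp only [E, if_pos hxy', if_neg hzw']
        exact L.bracket_eq_zero_symm (hu.mem hzw' hb) (hu.loop_mem hm ha)
          (hu.bracket_loop_eq_zero hm hzw' hyz.symm hwx ha hb)
    · by_cases hzw' : baseIndex z = baseIndex w
      · obtain rfl := eq_swap hzw' hzw
        simp only [E, if_neg hxy', if_pos hzw']
        exact hu.bracket_loop_eq_zero hm hxy' hwx.symm hyz hb ha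
      · simp only [E, if_neg hxy', if_neg hzw']
        exact hu.zero hxy' hzw' hyz hwx a b

end IsRootFamily

end RootFamily

/-! ### Root vectors in `stp_m(S ⊕ S^op, ex)` -/

section Exchange

theorem map_units_smul {k M N : Type*} [CommRing k] [AddCommGroup M] [Module k M] [AddCommGroup N]
    [Module k N] (f : M →ₗ[k] N) (s : ℤˣ) (x : M) : f (s • x) = s • f x := by
  rw [Units.smul_def, map_zsmul, Units.smul_def]

theorem LieSuperalgebra.bracket_units_smul {k : Type u} [CommRing k]
    (L : LieSuperalgebra.{u, v} k) (s : ℤˣ) (x y : L.carrier) :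
    L.bracket (s • x) y = s • L.bracket x y := by
  rw [map_units_smul, LinearMap.smul_apply]

variable {k : Type u} [CommRing k] {S : Type v} [Ring S] [Algebra k S]
  {𝒮 : ZMod 2 → Submodule k S} [GradedAlgebra 𝒮] {m : ℕ}

theorem inl_mem {p : ZMod 2} {a : S} (ha : a ∈ 𝒮 p) :
    ((a, 0) : S × SuperOp 𝒮) ∈ prodGrading 𝒮 (opGrading 𝒮) p :=
  ⟨ha, zero_mem _⟩

theorem inr_mem {p : ZMod 2} {a : S} (ha : a ∈ 𝒮 p) :
    ((0, toOp 𝒮 a) : S × SuperOp 𝒮) ∈ prodGrading 𝒮 (opGrading 𝒮) p :=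
  ⟨zero_mem _, toOp_mem ha⟩

theorem rho_inl (a : S) :
    rho (prodGrading 𝒮 (opGrading 𝒮)) (a, 0) = ((rho 𝒮 a, 0) : S × SuperOp 𝒮) := by
  refine linearMap_eq_of_homogeneous 𝒮
    (f := rho (prodGrading 𝒮 (opGrading 𝒮)) ∘ₗ LinearMap.inl k S (SuperOp 𝒮))
    (g := LinearMap.inl k S (SuperOp 𝒮) ∘ₗ rho 𝒮) (fun p a ha => ?_) a
  change rho (prodGrading 𝒮 (opGrading 𝒮)) (a, 0) = LinearMap.inl k S (SuperOp 𝒮) (rho 𝒮 a)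
  rw [rho_of_mem (inl_mem ha), rho_of_mem ha, map_units_smul]
  rfl

theorem rho_inr (a : S) : rho (prodGrading 𝒮 (opGrading 𝒮)) (0, toOp 𝒮 a) =
    ((0, toOp 𝒮 (rho 𝒮 a)) : S × SuperOp 𝒮) := by
  let f : S →ₗ[k] S × SuperOp 𝒮 := LinearMap.inr k S (SuperOp 𝒮) ∘ₗ (toOp 𝒮).toLinearMap
  refine linearMap_eq_of_homogeneous 𝒮
    (f := rho (prodGrading 𝒮 (opGrading 𝒮)) ∘ₗ f) (g := f ∘ₗ rho 𝒮) (fun p a ha => ?_) a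
  change rho (prodGrading 𝒮 (opGrading 𝒮)) (0, toOp 𝒮 a) = f (rho 𝒮 a)
  rw [rho_of_mem (inr_mem ha), rho_of_mem ha, map_units_smul]
  rfl

theorem inr_mul_inr {p q : ZMod 2} {a b : S} (ha : a ∈ 𝒮 p) (hb : b ∈ 𝒮 q) :
    ((0, toOp 𝒮 a) * (0, toOp 𝒮 b) : S × SuperOp 𝒮) =
      ((-1 : ℤˣ) ^ (p * q)) • (0, toOp 𝒮 (b * a)) := by
  rw [Prod.mk_mul_mk, toOp_mul_toOp_of_mem ha hb, mul_zero, Prod.smul_mk, smul_zero]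

/-- The exchange superinvolution swaps the summands, so transposing the indices of `f` moves its
argument from `S` to `S^op`. This rule and its analogues for `g` make available relations that do
not apply to the original indices. -/
theorem stp.fLin_inl {i j : Fin m} (hij : i ≠ j) (a : S) :
    stp.fLin (exchange 𝒮) i j hij (a, 0) =
      stp.fLin (exchange 𝒮) j i hij.symm (0, toOp 𝒮 (rho 𝒮 a)) := by
  rw [← rho_inr]
  exact stp.fLin_bar (exchange 𝒮) hij (0, toOp 𝒮 a)

theorem stp.gLin_inl {i j : Fin m} (hij : i ≠ j) (a : S) :
    stp.gLin (exchange 𝒮) i j hij (a, 0) =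
      -stp.gLin (exchange 𝒮) j i hij.symm (0, toOp 𝒮 (rho 𝒮 a)) := by
  rw [← rho_inr]
  exact stp.gLin_bar (exchange 𝒮) hij (0, toOp 𝒮 a)

theorem stp.fLin_inr {i j : Fin m} (hij : i ≠ j) (a : S) :
    stp.fLin (exchange 𝒮) i j hij (0, toOp 𝒮 a) =
      stp.fLin (exchange 𝒮) j i hij.symm (rho 𝒮 a, 0) := by
  rw [← rho_inl]
  exact stp.fLin_bar (exchange 𝒮) hij (a, 0)

theorem stp.gLin_inr {i j : Fin m} (hij : i ≠ j) (a : S) :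
    stp.gLin (exchange 𝒮) i j hij (0, toOp 𝒮 a) =
      -stp.gLin (exchange 𝒮) j i hij.symm (rho 𝒮 a, 0) := by
  rw [← rho_inl]
  exact stp.gLin_bar (exchange 𝒮) hij (a, 0)

theorem stp.fLin_inl_of_mem {i j : Fin m} (hij : i ≠ j) {p : ZMod 2} {a : S} (ha : a ∈ 𝒮 p) :
    stp.fLin (exchange 𝒮) i j hij (a, 0) =
      ((-1 : ℤˣ) ^ p) • stp.fLin (exchange 𝒮) j i hij.symm (0, toOp 𝒮 a) := by
  rw [← map_units_smul, ← rho_of_mem (inr_mem ha), rho_inr, stp.fLin_inl]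

theorem stp.gLin_inl_of_mem {i j : Fin m} (hij : i ≠ j) {p : ZMod 2} {a : S} (ha : a ∈ 𝒮 p) :
    stp.gLin (exchange 𝒮) i j hij (a, 0) =
      -(((-1 : ℤˣ) ^ p) • stp.gLin (exchange 𝒮) j i hij.symm (0, toOp 𝒮 a)) := by
  rw [← map_units_smul, ← rho_of_mem (inr_mem ha), rho_inr, stp.gLin_inl]

/-! ### Products of root vectors in `stp_m(S ⊕ S^op, ex)` -/

section Mul

variable {i j l : Fin m} (hij : i ≠ j) (hjl : j ≠ l) (hil : i ≠ l) {p q : ZMod 2} {a b : S}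
  (ha : a ∈ 𝒮 p) (hb : b ∈ 𝒮 q)

include ha hb

/-- The indices compose only in the opposite order. The sign of skew-symmetry then cancels the sign
of the product in `S^op`, leaving a single minus. -/
theorem stp.bracket_tLin_inr_tLin_inr :
    (stp (exchange 𝒮) m).bracket (stp.tLin (exchange 𝒮) j i hij.symm (0, toOp 𝒮 a))
      (stp.tLin (exchange 𝒮) l j hjl.symm (0, toOp 𝒮 b)) =
        -stp.tLin (exchange 𝒮) l i hil.symm (0, toOp 𝒮 (a * b)) := by
  rw [(stp (exchange 𝒮) m).skew (stp.tLin_mem _ _ _ _ (inr_mem ha))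
    (stp.tLin_mem _ _ _ _ (inr_mem hb)), stp.bracket_tLin_tLin _ _ _ hil.symm,
    inr_mul_inr hb ha, map_units_smul, smul_smul, ← uzpow_add]
  congr 1
  have h : ∀ p q : ZMod 2, (-1 : ℤˣ) ^ (p * q + q * p) = 1 := by decide
  rw [h, one_smul]

/-- The presentation has a product relation for `f` followed by `g`, not for `g` followed by `f`.
Transposing both elements into `S^op` and exchanging them brings the bracket to the listed form. -/
theorem stp.bracket_gLin_inl_fLin_inl :
    (stp (exchange 𝒮) m).bracket (stp.gLin (exchange 𝒮) i j hij (a, 0))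
      (stp.fLin (exchange 𝒮) j l hjl (b, 0)) =
        -stp.tLin (exchange 𝒮) l i hil.symm (0, toOp 𝒮 (a * b)) := by
  rw [stp.gLin_inl_of_mem hij ha, stp.fLin_inl_of_mem hjl hb, map_neg, LinearMap.neg_apply,
    LieSuperalgebra.bracket_units_smul, map_units_smul,
    (stp (exchange 𝒮) m).skew (stp.gLin_mem _ _ _ _ (inr_mem ha))
    (stp.fLin_mem _ _ _ _ (inr_mem hb)), stp.bracket_fLin_gLin _ _ _ hil.symm,
    inr_mul_inr hb ha, map_units_smul]
  simp only [smul_neg, smul_smul, ← uzpow_add]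
  -- The exponent collects `p` and `q` from the two transpositions, `(p + 1) * (q + 1)` from
  -- skew-symmetry of elements of shifted parity, and `q * p` from the product in `S^op`.
  have h : ∀ p q : ZMod 2, (-1 : ℤˣ) ^ (p + (q + ((p + 1) * (q + 1) + q * p))) = -1 := by decide
  rw [h, Units.neg_smul, one_smul, neg_neg]

/-- Transpose `f` into `S^op`, exchange the factors to apply the relation for `t` and `f`, and read
the transposed result back in `S`. The bracket of `t` with `g` below is treated in the same way. -/
theorem stp.bracket_fLin_inl_tLin_inr :
    (stp (exchange 𝒮) m).bracket (stp.fLin (exchange 𝒮) i j hij (a, 0))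
      (stp.tLin (exchange 𝒮) l j hjl.symm (0, toOp 𝒮 b)) =
        -stp.fLin (exchange 𝒮) i l hil (a * b, 0) := by
  rw [stp.fLin_inl_of_mem hij ha, stp.fLin_inl_of_mem hil (SetLike.mul_mem_graded ha hb),
    LieSuperalgebra.bracket_units_smul,
    (stp (exchange 𝒮) m).skew (stp.fLin_mem _ _ _ _ (inr_mem ha))
    (stp.tLin_mem _ _ _ _ (inr_mem hb)), stp.bracket_tLin_fLin _ _ _ hil.symm,
    inr_mul_inr hb ha, map_units_smul, smul_neg, smul_smul, smul_smul, ← uzpow_add, ← uzpow_add]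
  have h : ∀ p q : ZMod 2, p + (p + 1) * q + q * p = p + q := by decide
  simp only [h]

theorem stp.bracket_tLin_inr_gLin_inl :
    (stp (exchange 𝒮) m).bracket (stp.tLin (exchange 𝒮) j i hij.symm (0, toOp 𝒮 a))
      (stp.gLin (exchange 𝒮) j l hjl (b, 0)) =
        -stp.gLin (exchange 𝒮) i l hil (a * b, 0) := by
  rw [stp.gLin_inl_of_mem hjl hb, stp.gLin_inl_of_mem hil (SetLike.mul_mem_graded ha hb),
    map_neg, map_units_smul,
    (stp (exchange 𝒮) m).skew (stp.tLin_mem _ _ _ _ (inr_mem ha))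
    (stp.gLin_mem _ _ _ _ (inr_mem hb)), stp.bracket_gLin_tLin _ _ _ hil.symm,
    inr_mul_inr hb ha, map_units_smul, smul_neg, smul_smul, smul_smul, ← uzpow_add, ← uzpow_add]
  have h : ∀ p q : ZMod 2, q + p * (q + 1) + q * p = p + q := by decide
  simp only [h]

end Mul

/-! ### Vanishing brackets of root vectors in `stp_m(S ⊕ S^op, ex)` -/

section Zero

variable {i j l r : Fin m} (hij : i ≠ j) (hlr : l ≠ r) (h : ¬(i = l ∧ j = r)) (a b : S)

include h

/-- The relations give the vanishing directly unless `j = r`. In that case transposing `f` makes the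
indices composable, and the bracket becomes `f_{il}` of a product of an element of `S` with one of
`S^op`, which is zero. That product relation needs `i ≠ l`, which is what the hypothesis `h`
supplies; it plays the same part in the following lemmas. -/
theorem stp.bracket_tLin_inl_fLin_inl_zero (hjl : j ≠ l) :
    (stp (exchange 𝒮) m).bracket (stp.tLin (exchange 𝒮) i j hij (a, 0))
      (stp.fLin (exchange 𝒮) l r hlr (b, 0)) = 0 := by
  by_cases hjr : j = r
  · subst hjr
    have hil : i ≠ l := fun e => h ⟨e, rfl⟩
    rw [stp.fLin_inl, stp.bracket_tLin_fLin _ _ _ hil, Prod.mk_mul_mk, mul_zero, zero_mul]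
    exact map_zero _
  · exact stp.bracket_tLin_fLin_zero _ _ hjl _ (Ne.symm hjr) _ _

theorem stp.bracket_gLin_inl_tLin_inl_zero (hil : l ≠ j) :
    (stp (exchange 𝒮) m).bracket (stp.gLin (exchange 𝒮) i j hij (a, 0))
      (stp.tLin (exchange 𝒮) l r hlr (b, 0)) = 0 := by
  by_cases hil' : i = l
  · subst hil'
    have hjr : j ≠ r := fun e => h ⟨rfl, e⟩
    rw [stp.gLin_inl, map_neg, LinearMap.neg_apply, stp.bracket_gLin_tLin _ _ _ hjr,
      Prod.mk_mul_mk, mul_zero, zero_mul, neg_eq_zero]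
    exact map_zero _
  · exact stp.bracket_gLin_tLin_zero _ _ hil _ hil' _ _

/-- For four distinct indices this is a relation. If `i = l`, transposing `f` gives a composable
pair with arguments in different summands; if `j = r`, transposing `g` does. -/
theorem stp.bracket_fLin_inl_gLin_inl_zero (hjl : j ≠ l) (hir : i ≠ r) :
    (stp (exchange 𝒮) m).bracket (stp.fLin (exchange 𝒮) i j hij (a, 0))
      (stp.gLin (exchange 𝒮) l r hlr (b, 0)) = 0 := by
  by_cases hil : i = l
  · subst hil
    have hjr : j ≠ r := fun e => h ⟨rfl, e⟩
    rw [stp.fLin_inl, stp.bracket_fLin_gLin _ _ _ hjr, Prod.mk_mul_mk, mul_zero, zero_mul]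
    exact map_zero _
  · by_cases hjr : j = r
    · subst hjr
      rw [stp.gLin_inl, map_neg, stp.bracket_fLin_gLin _ _ _ hil, Prod.mk_mul_mk, mul_zero,
        zero_mul, neg_eq_zero]
      exact map_zero _
    · exact stp.bracket_fLin_gLin_zero _ _ hil hir hjl hjr _ _ _

/-- No transposition is needed here: when `i = l` the indices already compose, and the arguments lie
in different summands. -/
theorem stp.bracket_tLin_inr_fLin_inl_zero (hlj : l ≠ j) :
    (stp (exchange 𝒮) m).bracket (stp.tLin (exchange 𝒮) r l hlr.symm (0, toOp 𝒮 b))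
      (stp.fLin (exchange 𝒮) i j hij (a, 0)) = 0 := by
  by_cases hil : i = l
  · subst hil
    have hrj : r ≠ j := fun e => h ⟨rfl, e.symm⟩
    rw [stp.bracket_tLin_fLin _ _ _ hrj, Prod.mk_mul_mk, mul_zero, zero_mul]
    exact map_zero _
  · exact stp.bracket_tLin_fLin_zero _ _ (Ne.symm hil) _ hlj.symm _ _

theorem stp.bracket_gLin_inl_tLin_inr_zero (hri : r ≠ i) :
    (stp (exchange 𝒮) m).bracket (stp.gLin (exchange 𝒮) i j hij (a, 0))
      (stp.tLin (exchange 𝒮) r l hlr.symm (0, toOp 𝒮 b)) = 0 := by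
  by_cases hjr : j = r
  · subst hjr
    have hil : i ≠ l := fun e => h ⟨e, rfl⟩
    rw [stp.bracket_gLin_tLin _ _ _ hil, Prod.mk_mul_mk, mul_zero, zero_mul]
    exact map_zero _
  · exact stp.bracket_gLin_tLin_zero _ _ (Ne.symm hjr) _ hri.symm _ _

/-- The pair may be composable in either order, `j = r` or `i = l`, and each time the product of the
arguments is zero. The hypothesis `h` rules out both at once, where no relation applies to the
bracket. -/
theorem stp.bracket_tLin_inl_tLin_inr_zero {p q : ZMod 2} {a b : S} (ha : a ∈ 𝒮 p)
    (hb : b ∈ 𝒮 q) :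
    (stp (exchange 𝒮) m).bracket (stp.tLin (exchange 𝒮) i j hij (a, 0))
      (stp.tLin (exchange 𝒮) r l hlr.symm (0, toOp 𝒮 b)) = 0 := by
  by_cases hjr : j = r
  · subst hjr
    have hil : i ≠ l := fun e => h ⟨e, rfl⟩
    rw [stp.bracket_tLin_tLin _ _ _ hil, Prod.mk_mul_mk, mul_zero, zero_mul]
    exact map_zero _
  · by_cases hil : i = l
    · subst hil
      refine (stp (exchange 𝒮) m).bracket_eq_zero_symm (stp.tLin_mem _ _ _ _ (inr_mem hb))
        (stp.tLin_mem _ _ _ _ (inl_mem ha)) ?_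
      rw [stp.bracket_tLin_tLin _ _ _ (Ne.symm hjr), Prod.mk_mul_mk, mul_zero, zero_mul]
      exact map_zero _
    · exact stp.bracket_tLin_tLin_zero _ _ hjr _ (Ne.symm hil) _ _

end Zero

variable (𝒮) in
/-- The images of the `e_{xy}(a)` in `stp_m(S ⊕ S^op, ex)`, for indices `x` and `y` with distinct
underlying indices in `{1, …, m}`. -/
def stp.root : Fin m ⊕ Fin m → Fin m ⊕ Fin m → S →ₗ[k] (stp (exchange 𝒮) m).carrier
  | .inl i, .inl j => if h : i ≠ j then
      stp.tLin (exchange 𝒮) i j h ∘ₗ LinearMap.inl k S (SuperOp 𝒮) else 0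
  | .inl i, .inr j => if h : i ≠ j then
      stp.fLin (exchange 𝒮) i j h ∘ₗ LinearMap.inl k S (SuperOp 𝒮) else 0
  | .inr i, .inl j => if h : i ≠ j then
      stp.gLin (exchange 𝒮) i j h ∘ₗ LinearMap.inl k S (SuperOp 𝒮) else 0
  | .inr i, .inr j => if h : i ≠ j then
      -(stp.tLin (exchange 𝒮) j i h.symm ∘ₗ LinearMap.inr k S (SuperOp 𝒮) ∘ₗ
        (toOp 𝒮).toLinearMap) else 0

theorem stp.root_inl_inl {i j : Fin m} (h : i ≠ j) (a : S) :
    stp.root 𝒮 (.inl i) (.inl j) a = stp.tLin (exchange 𝒮) i j h (a, 0) := by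
  rw [stp.root, dif_pos h]
  rfl

theorem stp.root_inl_inr {i j : Fin m} (h : i ≠ j) (a : S) :
    stp.root 𝒮 (.inl i) (.inr j) a = stp.fLin (exchange 𝒮) i j h (a, 0) := by
  rw [stp.root, dif_pos h]
  rfl

theorem stp.root_inr_inl {i j : Fin m} (h : i ≠ j) (a : S) :
    stp.root 𝒮 (.inr i) (.inl j) a = stp.gLin (exchange 𝒮) i j h (a, 0) := by
  rw [stp.root, dif_pos h]
  rfl

theorem stp.root_inr_inr {i j : Fin m} (h : i ≠ j) (a : S) :
    stp.root 𝒮 (.inr i) (.inr j) a = -stp.tLin (exchange 𝒮) j i h.symm (0, toOp 𝒮 a) := by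
  rw [stp.root, dif_pos h]
  rfl

theorem stp.root_mem {x y : Fin m ⊕ Fin m} (hxy : baseIndex x ≠ baseIndex y) {p : ZMod 2} {a : S}
    (ha : a ∈ 𝒮 p) :
    stp.root 𝒮 x y a ∈ (stp (exchange 𝒮) m).grading (indexParity x + indexParity y + p) := by
  rcases x with i | i <;> rcases y with j | j <;> simp only [baseIndex_inl, baseIndex_inr] at hxy
  · rw [stp.root_inl_inl hxy]
    convert stp.tLin_mem (exchange 𝒮) i j hxy (inl_mem ha) using 2
    simp [indexParity]
  · rw [stp.root_inl_inr hxy]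
    convert stp.fLin_mem (exchange 𝒮) i j hxy (inl_mem ha) using 2
    simp [indexParity, add_comm]
  · rw [stp.root_inr_inl hxy]
    convert stp.gLin_mem (exchange 𝒮) i j hxy (inl_mem ha) using 2
    simp [indexParity, add_comm]
  · rw [stp.root_inr_inr hxy]
    refine neg_mem ?_
    convert stp.tLin_mem (exchange 𝒮) j i hxy.symm (inr_mem ha) using 2
    simp [indexParity, CharTwo.add_self_eq_zero]

theorem stp.root_mul {x y z : Fin m ⊕ Fin m} (hxy : baseIndex x ≠ baseIndex y)
    (hyz : baseIndex y ≠ baseIndex z) (hxz : baseIndex x ≠ baseIndex z) (a b : S) :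
    (stp (exchange 𝒮) m).bracket (stp.root 𝒮 x y a) (stp.root 𝒮 y z b) =
      stp.root 𝒮 x z (a * b) := by
  refine bilinear_eq_of_homogeneous 𝒮 𝒮
    (f := (stp (exchange 𝒮) m).bracket.compl₁₂ (stp.root 𝒮 x y) (stp.root 𝒮 y z))
    (g := (LinearMap.mul k S).compr₂ (stp.root 𝒮 x z)) (fun p q a ha b hb => ?_) a b
  change (stp (exchange 𝒮) m).bracket (stp.root 𝒮 x y a) (stp.root 𝒮 y z b) =
    stp.root 𝒮 x z (a * b)
  rcases x with i | i <;> rcases y with j | j <;> rcases z with l | l <;>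
    simp only [baseIndex_inl, baseIndex_inr] at hxy hyz hxz
  · rw [stp.root_inl_inl hxy, stp.root_inl_inl hyz, stp.root_inl_inl hxz,
      stp.bracket_tLin_tLin _ _ _ hxz, Prod.mk_mul_mk, mul_zero]
  · rw [stp.root_inl_inl hxy, stp.root_inl_inr hyz, stp.root_inl_inr hxz,
      stp.bracket_tLin_fLin _ _ _ hxz, Prod.mk_mul_mk, mul_zero]
  · rw [stp.root_inl_inr hxy, stp.root_inr_inl hyz, stp.root_inl_inl hxz,
      stp.bracket_fLin_gLin _ _ _ hxz, Prod.mk_mul_mk, mul_zero]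
  · rw [stp.root_inl_inr hxy, stp.root_inr_inr hyz, stp.root_inl_inr hxz, map_neg,
      stp.bracket_fLin_inl_tLin_inr hxy hyz hxz ha hb, neg_neg]
  · rw [stp.root_inr_inl hxy, stp.root_inl_inl hyz, stp.root_inr_inl hxz,
      stp.bracket_gLin_tLin _ _ _ hxz, Prod.mk_mul_mk, mul_zero]
  · rw [stp.root_inr_inl hxy, stp.root_inl_inr hyz, stp.root_inr_inr hxz,
      stp.bracket_gLin_inl_fLin_inl hxy hyz hxz ha hb]
  · rw [stp.root_inr_inr hxy, stp.root_inr_inl hyz, stp.root_inr_inl hxz, map_neg,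
      LinearMap.neg_apply, stp.bracket_tLin_inr_gLin_inl hxy hyz hxz ha hb, neg_neg]
  · rw [stp.root_inr_inr hxy, stp.root_inr_inr hyz, stp.root_inr_inr hxz, map_neg, map_neg,
      LinearMap.neg_apply, neg_neg, stp.bracket_tLin_inr_tLin_inr hxy hyz hxz ha hb]

/-- One case for each choice of blocks for the two root vectors. Cases listed in the reverse order
are recovered by skew-symmetry through `symm`. Coinciding pairs of bases are excluded because the
preceding lemmas cannot treat them one bracket at a time. -/
theorem stp.root_zero_of_not {x y z w : Fin m ⊕ Fin m} (hxy : baseIndex x ≠ baseIndex y)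
    (hzw : baseIndex z ≠ baseIndex w) (hyz : y ≠ z) (hwx : w ≠ x)
    (h : ¬(baseIndex x = baseIndex z ∧ baseIndex y = baseIndex w)) {p q : ZMod 2} {a b : S}
    (ha : a ∈ 𝒮 p) (hb : b ∈ 𝒮 q) :
    (stp (exchange 𝒮) m).bracket (stp.root 𝒮 x y a) (stp.root 𝒮 z w b) = 0 := by
  have h' : ¬(baseIndex z = baseIndex x ∧ baseIndex w = baseIndex y) := fun e =>
    h ⟨e.1.symm, e.2.symm⟩
  have symm := (stp (exchange 𝒮) m).bracket_eq_zero_symm (stp.root_mem hzw hb)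
    (stp.root_mem hxy ha)
  have hyz' := hyz.symm
  have hwx' := hwx.symm
  rcases x with i | i <;> rcases y with j | j <;> rcases z with l | l <;> rcases w with r | r <;>
    simp only [baseIndex_inl, baseIndex_inr] at hxy hzw h h' <;>
    simp only [ne_eq, Sum.inl.injEq, Sum.inr.injEq, reduceCtorEq, not_false_eq_true]
      at hyz hwx hyz' hwx' <;>
    simp only [stp.root_inl_inl hxy, stp.root_inl_inr hxy, stp.root_inr_inl hxy,
      stp.root_inr_inr hxy, stp.root_inl_inl hzw, stp.root_inl_inr hzw, stp.root_inr_inl hzw,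
      stp.root_inr_inr hzw, map_neg, LinearMap.neg_apply, neg_eq_zero, neg_neg] at symm ⊢
  · exact stp.bracket_tLin_tLin_zero _ _ hyz _ hwx _ _
  · exact stp.bracket_tLin_inl_fLin_inl_zero hxy hzw h _ _ hyz
  · exact symm (stp.bracket_gLin_inl_tLin_inl_zero hzw hxy h' _ _ hwx')
  · exact stp.bracket_tLin_inl_tLin_inr_zero hxy hzw h ha hb
  · exact symm (stp.bracket_tLin_inl_fLin_inl_zero hzw hxy h' _ _ hwx)
  · exact stp.bracket_fLin_fLin_zero _ _ _ _ _
  · exact stp.bracket_fLin_inl_gLin_inl_zero hxy hzw h _ _ hyz hwx'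
  · exact symm (stp.bracket_tLin_inr_fLin_inl_zero hxy hzw h _ _ hyz')
  · exact stp.bracket_gLin_inl_tLin_inl_zero hxy hzw h _ _ hyz'
  · exact symm (stp.bracket_fLin_inl_gLin_inl_zero hzw hxy h' _ _ hwx hyz')
  · exact stp.bracket_gLin_gLin_zero _ _ _ _ _
  · exact stp.bracket_gLin_inl_tLin_inr_zero hxy hzw h _ _ hwx
  · exact symm (stp.bracket_tLin_inl_tLin_inr_zero hzw hxy h' hb ha)
  · exact stp.bracket_tLin_inr_fLin_inl_zero hzw hxy h' _ _ hwx'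
  · exact symm (stp.bracket_gLin_inl_tLin_inr_zero hzw hxy h' _ _ hyz)
  · exact stp.bracket_tLin_tLin_zero _ _ hwx' _ hyz' _ _

variable (𝒮) in
theorem stp.isRootFamily_root (hm : 3 ≤ m) :
    IsRootFamily 𝒮 (stp (exchange 𝒮) m) (stp.root 𝒮) where
  mem hxy _ _ ha := stp.root_mem hxy ha
  mul := stp.root_mul
  zero {x y z w} hxy hzw hyz hwx a b := by
    refine bilinear_eq_of_homogeneous 𝒮 𝒮
      (f := (stp (exchange 𝒮) m).bracket.compl₁₂ (stp.root 𝒮 x y) (stp.root 𝒮 z w))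
      (g := 0) (fun p q a ha b hb => ?_) a b
    change (stp (exchange 𝒮) m).bracket (stp.root 𝒮 x y a) (stp.root 𝒮 z w b) = 0
    by_cases h : baseIndex x = baseIndex z ∧ baseIndex y = baseIndex w
    -- When both pairs of bases coincide, factor the second root vector as a bracket through an
    -- index `v` of a third base. Neither factor has the same pair of bases as the first root
    -- vector, so both are annihilated by it.
    · obtain ⟨v, hzv, hwv⟩ := exists_baseIndex_ne_ne hm z w
      have h1 := SetLike.one_mem_graded 𝒮
      rw [← one_mul b, ← stp.root_mul hzv hwv.symm hzw]
      refine (stp (exchange 𝒮) m).bracket_bracket_eq_zero (stp.root_mem hxy ha)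
        (stp.root_mem hzv h1) ?_ ?_
      · exact stp.root_zero_of_not hxy hzv hyz (ne_of_baseIndex_ne (h.1 ▸ hzv.symm))
          (fun e => hwv (h.2 ▸ e.2)) ha h1
      · exact stp.root_zero_of_not hxy hwv.symm (ne_of_baseIndex_ne (h.2 ▸ hwv)) hwx
          (fun e => hzv (h.1 ▸ e.1)) ha hb
    · exact stp.root_zero_of_not hxy hzw hyz hwx h ha hb

end Exchange

/-! ### The homomorphism from `stp_m(S ⊕ S^op, ex)` to `st_{m|m}(S)` -/

section ToSt

variable {k : Type u} [CommRing k] {S : Type v} [Ring S] [Algebra k S]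
  {𝒮 : ZMod 2 → Submodule k S} [GradedAlgebra 𝒮] {m : ℕ}

/-- The `S^op` part of a periplectic generator appears in `st` with transposed indices, so its
products come in this reversed order. -/
theorem st.bracket_eLin_rev {n : ℕ} {i j l : Fin m ⊕ Fin n} (hij : i ≠ j) (hli : l ≠ i)
    (hlj : l ≠ j) {p q : ZMod 2} {a b : S} (ha : a ∈ 𝒮 p) (hb : b ∈ 𝒮 q) :
    (st 𝒮 m n).bracket (st.eLin 𝒮 i j hij a) (st.eLin 𝒮 l i hli b) =
      -(((-1 : ℤˣ) ^ ((indexParity i + indexParity j + p) * (indexParity l + indexParity i + q))) •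
        st.eLin 𝒮 l j hlj (b * a)) := by
  rw [(st 𝒮 m n).skew (st.eLin_mem _ _ _ ha) (st.eLin_mem _ _ _ hb), st.bracket_eLin _ _ _ hlj]

theorem exists_eq_of_mem_prodGrading {p : ZMod 2} {x : S × SuperOp 𝒮}
    (hx : x ∈ prodGrading 𝒮 (opGrading 𝒮) p) :
    ∃ a ∈ 𝒮 p, ∃ b ∈ 𝒮 p, x = (a, toOp 𝒮 b) := by
  obtain ⟨b, hb, e⟩ := opGrading_cases hx.2
  exact ⟨x.1, hx.1, b, hb, Prod.ext rfl e⟩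

theorem mk_mul_mk_of_mem {p q : ZMod 2} (a c : S) {b d : S} (hb : b ∈ 𝒮 p) (hd : d ∈ 𝒮 q) :
    ((a, toOp 𝒮 b) * (c, toOp 𝒮 d) : S × SuperOp 𝒮) =
      (a * c, toOp 𝒮 (((-1 : ℤˣ) ^ (p * q)) • (d * b))) := by
  rw [Prod.mk_mul_mk, toOp_mul_toOp_of_mem hb hd]
  rfl

theorem rho_rho (a : S) : rho 𝒮 (rho 𝒮 a) = a := by
  refine linearMap_eq_of_homogeneous 𝒮 (f := rho 𝒮 ∘ₗ rho 𝒮) (g := LinearMap.id)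
    (fun p a ha => ?_) a
  rw [LinearMap.comp_apply, rho_of_mem (rho_mem ha), rho_of_mem ha, smul_smul, ← uzpow_add,
    CharTwo.add_self_eq_zero, uzpow_zero, one_smul, LinearMap.id_apply]

theorem rho_prod (a b : S) : rho (prodGrading 𝒮 (opGrading 𝒮)) (a, toOp 𝒮 b) =
    ((rho 𝒮 a, toOp 𝒮 (rho 𝒮 b)) : S × SuperOp 𝒮) := by
  have h := congrArg₂ (· + ·) (rho_inl (𝒮 := 𝒮) a) (rho_inr (𝒮 := 𝒮) b)
  simpa only [← map_add, Prod.mk_add_mk, add_zero, zero_add] using h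

variable (𝒮) in
/-- The projection of `S ⊕ S^op` onto its second summand. -/
def prodSnd : S × SuperOp 𝒮 →ₗ[k] S := (toOp 𝒮).symm.toLinearMap ∘ₗ LinearMap.snd k S (SuperOp 𝒮)

variable (𝒮) in
/-- The image of `t_{ij}` in `st_{m|m}(S)`. -/
def st.tLin (i j : Fin m) (hij : i ≠ j) : S × SuperOp 𝒮 →ₗ[k] (st 𝒮 m m).carrier :=
  st.eLin 𝒮 (.inl i) (.inl j) (Sum.inl_injective.ne hij) ∘ₗ LinearMap.fst k S (SuperOp 𝒮) -
    st.eLin 𝒮 (.inr j) (.inr i) (Sum.inr_injective.ne hij.symm) ∘ₗ prodSnd 𝒮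

variable (𝒮) in
/-- The image of `f_{ij}` in `st_{m|m}(S)`. -/
def st.fLin (i j : Fin m) (_ : i ≠ j) : S × SuperOp 𝒮 →ₗ[k] (st 𝒮 m m).carrier :=
  st.eLin 𝒮 (.inl i) (.inr j) Sum.inl_ne_inr ∘ₗ LinearMap.fst k S (SuperOp 𝒮) +
    st.eLin 𝒮 (.inl j) (.inr i) Sum.inl_ne_inr ∘ₗ rho 𝒮 ∘ₗ prodSnd 𝒮

variable (𝒮) in
/-- The image of `g_{ij}` in `st_{m|m}(S)`. -/
def st.gLin (i j : Fin m) (_ : i ≠ j) : S × SuperOp 𝒮 →ₗ[k] (st 𝒮 m m).carrier :=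
  st.eLin 𝒮 (.inr i) (.inl j) Sum.inr_ne_inl ∘ₗ LinearMap.fst k S (SuperOp 𝒮) -
    st.eLin 𝒮 (.inr j) (.inl i) Sum.inr_ne_inl ∘ₗ rho 𝒮 ∘ₗ prodSnd 𝒮

theorem st.tLin_apply (i j : Fin m) (hij : i ≠ j) (a b : S) : st.tLin 𝒮 i j hij (a, toOp 𝒮 b) =
    st.eLin 𝒮 (.inl i) (.inl j) (Sum.inl_injective.ne hij) a -
      st.eLin 𝒮 (.inr j) (.inr i) (Sum.inr_injective.ne hij.symm) b := rfl

theorem st.fLin_apply (i j : Fin m) (hij : i ≠ j) (a b : S) : st.fLin 𝒮 i j hij (a, toOp 𝒮 b) =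
    st.eLin 𝒮 (.inl i) (.inr j) Sum.inl_ne_inr a +
      st.eLin 𝒮 (.inl j) (.inr i) Sum.inl_ne_inr (rho 𝒮 b) := rfl

theorem st.gLin_apply (i j : Fin m) (hij : i ≠ j) (a b : S) : st.gLin 𝒮 i j hij (a, toOp 𝒮 b) =
    st.eLin 𝒮 (.inr i) (.inl j) Sum.inr_ne_inl a -
      st.eLin 𝒮 (.inr j) (.inl i) Sum.inr_ne_inl (rho 𝒮 b) := rfl

theorem st.tLin_mem {i j : Fin m} (hij : i ≠ j) {p : ZMod 2} {x : S × SuperOp 𝒮}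
    (hx : x ∈ prodGrading 𝒮 (opGrading 𝒮) p) :
    st.tLin 𝒮 i j hij x ∈ (st 𝒮 m m).grading p := by
  obtain ⟨a, ha, b, hb, rfl⟩ := exists_eq_of_mem_prodGrading hx
  rw [st.tLin_apply]
  have h1 := st.eLin_mem (.inl i : Fin m ⊕ Fin m) (.inl j) (Sum.inl_injective.ne hij) ha
  have h2 := st.eLin_mem (.inr j : Fin m ⊕ Fin m) (.inr i) (Sum.inr_injective.ne hij.symm) hb
  simp only [indexParity, CharTwo.add_self_eq_zero, zero_add] at h1 h2
  exact sub_mem h1 h2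

theorem st.fLin_mem {i j : Fin m} (hij : i ≠ j) {p : ZMod 2} {x : S × SuperOp 𝒮}
    (hx : x ∈ prodGrading 𝒮 (opGrading 𝒮) p) :
    st.fLin 𝒮 i j hij x ∈ (st 𝒮 m m).grading (p + 1) := by
  obtain ⟨a, ha, b, hb, rfl⟩ := exists_eq_of_mem_prodGrading hx
  rw [st.fLin_apply, add_comm p]
  have h1 := st.eLin_mem (.inl i : Fin m ⊕ Fin m) (.inr j) Sum.inl_ne_inr ha
  have h2 := st.eLin_mem (.inl j : Fin m ⊕ Fin m) (.inr i) Sum.inl_ne_inr (rho_mem hb)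
  simp only [indexParity, zero_add] at h1 h2
  exact add_mem h1 h2

theorem st.gLin_mem {i j : Fin m} (hij : i ≠ j) {p : ZMod 2} {x : S × SuperOp 𝒮}
    (hx : x ∈ prodGrading 𝒮 (opGrading 𝒮) p) :
    st.gLin 𝒮 i j hij x ∈ (st 𝒮 m m).grading (p + 1) := by
  obtain ⟨a, ha, b, hb, rfl⟩ := exists_eq_of_mem_prodGrading hx
  rw [st.gLin_apply, add_comm p]
  have h1 := st.eLin_mem (.inr i : Fin m ⊕ Fin m) (.inl j) Sum.inr_ne_inl ha
  have h2 := st.eLin_mem (.inr j : Fin m ⊕ Fin m) (.inl i) Sum.inr_ne_inl (rho_mem hb)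
  simp only [indexParity, add_zero] at h1 h2
  exact sub_mem h1 h2

/-! ### The product relations of `stp` for elements of `st_{m|m}(S)` -/

section Relations

variable {i j l r : Fin m} {p q : ZMod 2} {x y : S × SuperOp 𝒮}
  (hx : x ∈ prodGrading 𝒮 (opGrading 𝒮) p) (hy : y ∈ prodGrading 𝒮 (opGrading 𝒮) q)

include hx hy

/-- Of the four terms, the two mixing the diagonal blocks vanish. The `S`-terms compose as they
stand, and the `S^op`-terms compose in reverse, where the sign of skew-symmetry is that of the
product in `S^op`. -/
theorem st.bracket_tLin_tLin (hij : i ≠ j) (hjl : j ≠ l) (hil : i ≠ l) :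
    (st 𝒮 m m).bracket (st.tLin 𝒮 i j hij x) (st.tLin 𝒮 j l hjl y) =
      st.tLin 𝒮 i l hil (x * y) := by
  obtain ⟨a, ha, b, hb, rfl⟩ := exists_eq_of_mem_prodGrading hx
  obtain ⟨c, hc, d, hd, rfl⟩ := exists_eq_of_mem_prodGrading hy
  rw [mk_mul_mk_of_mem a c hb hd]
  simp only [st.tLin_apply, map_sub, LinearMap.sub_apply]
  rw [st.bracket_eLin _ _ _ (Sum.inl_injective.ne hil),
    st.bracket_eLin_rev _ _ (Sum.inr_injective.ne hil.symm) hb hd,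
    st.bracket_eLin_zero _ _ ?_ _ ?_, st.bracket_eLin_zero _ _ ?_ _ ?_, map_units_smul]
  simp only [indexParity, CharTwo.add_self_eq_zero, zero_add]
  · abel
  all_goals simp

theorem st.bracket_tLin_fLin (hij : i ≠ j) (hjl : j ≠ l) (hil : i ≠ l) :
    (st 𝒮 m m).bracket (st.tLin 𝒮 i j hij x) (st.fLin 𝒮 j l hjl y) =
      st.fLin 𝒮 i l hil (x * y) := by
  obtain ⟨a, ha, b, hb, rfl⟩ := exists_eq_of_mem_prodGrading hx
  obtain ⟨c, hc, d, hd, rfl⟩ := exists_eq_of_mem_prodGrading hy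
  rw [mk_mul_mk_of_mem a c hb hd]
  simp only [st.tLin_apply, st.fLin_apply, map_sub, map_add, LinearMap.sub_apply]
  rw [st.bracket_eLin _ _ _ Sum.inl_ne_inr,
    st.bracket_eLin_rev _ _ Sum.inl_ne_inr hb (rho_mem hd),
    st.bracket_eLin_zero _ _ ?_ _ ?_, st.bracket_eLin_zero _ _ ?_ _ ?_, rho_of_mem hd, map_units_smul,
    rho_of_mem (SetLike.mul_mem_graded hd hb)]
  simp only [indexParity, CharTwo.add_self_eq_zero, zero_add, map_units_smul, smul_mul_assoc,
    smul_smul, ← uzpow_add]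
  -- The element `e_{l,m+j}(ρ d)` has parity `1 + q`; the excess over the sign of the opposite
  -- product turns `ρ d` into `ρ` of the product.
  have h : ∀ p q : ZMod 2, p * (1 + q) + q = p * q + (q + p) := by decide
  rw [h]
  · abel
  all_goals simp [hjl, hjl.symm]

theorem st.bracket_gLin_tLin (hij : i ≠ j) (hjl : j ≠ l) (hil : i ≠ l) :
    (st 𝒮 m m).bracket (st.gLin 𝒮 i j hij x) (st.tLin 𝒮 j l hjl y) =
      st.gLin 𝒮 i l hil (x * y) := by
  obtain ⟨a, ha, b, hb, rfl⟩ := exists_eq_of_mem_prodGrading hx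
  obtain ⟨c, hc, d, hd, rfl⟩ := exists_eq_of_mem_prodGrading hy
  rw [mk_mul_mk_of_mem a c hb hd]
  simp only [st.tLin_apply, st.gLin_apply, map_sub, LinearMap.sub_apply]
  rw [st.bracket_eLin _ _ _ Sum.inr_ne_inl,
    st.bracket_eLin_rev _ _ Sum.inr_ne_inl (rho_mem hb) hd,
    st.bracket_eLin_zero _ _ ?_ _ ?_, st.bracket_eLin_zero _ _ ?_ _ ?_, rho_of_mem hb, map_units_smul,
    rho_of_mem (SetLike.mul_mem_graded hd hb)]
  simp only [indexParity, CharTwo.add_self_eq_zero, zero_add, add_zero, map_units_smul,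
    mul_smul_comm, smul_smul, ← uzpow_add]
  have h : ∀ p q : ZMod 2, (1 + p) * q + p = p * q + (q + p) := by decide
  rw [h]
  · abel
  all_goals simp [hij, hij.symm]

theorem st.bracket_fLin_gLin (hij : i ≠ j) (hjl : j ≠ l) (hil : i ≠ l) :
    (st 𝒮 m m).bracket (st.fLin 𝒮 i j hij x) (st.gLin 𝒮 j l hjl y) =
      st.tLin 𝒮 i l hil (x * y) := by
  obtain ⟨a, ha, b, hb, rfl⟩ := exists_eq_of_mem_prodGrading hx
  obtain ⟨c, hc, d, hd, rfl⟩ := exists_eq_of_mem_prodGrading hy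
  rw [mk_mul_mk_of_mem a c hb hd]
  simp only [st.tLin_apply, st.fLin_apply, st.gLin_apply, map_sub, map_add, LinearMap.add_apply]
  rw [st.bracket_eLin _ _ _ (Sum.inl_injective.ne hil),
    st.bracket_eLin_rev _ _ (Sum.inr_injective.ne hil.symm) (rho_mem hb) (rho_mem hd),
    st.bracket_eLin_zero _ _ ?_ _ ?_, st.bracket_eLin_zero _ _ ?_ _ ?_,
    rho_of_mem hb, rho_of_mem hd]
  simp only [indexParity, zero_add, add_zero, map_units_smul, mul_smul_comm,
    smul_mul_assoc, smul_smul, ← uzpow_add]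
  -- Both factors have shifted parity and both carry `ρ`. Together these contribute one extra minus,
  -- which produces the minus sign in the image of `t`.
  have h : ∀ p q : ZMod 2, (-1 : ℤˣ) ^ ((1 + p) * (1 + q) + (p + q)) = -(-1) ^ (p * q) := by decide
  simp only [h, Units.neg_smul]
  · abel
  all_goals simp [hij, hjl, hij.symm, hjl.symm]

end Relations

/-- This direction needs no auxiliary index, and therefore no lower bound on `m`. -/
theorem exists_hom_stp_st (𝒮 : ZMod 2 → Submodule k S) [GradedAlgebra 𝒮] (m : ℕ) :
    ∃ ψ : (stp (exchange 𝒮) m).Hom (st 𝒮 m m), ∀ i j hij x,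
      ψ (stp.tLin (exchange 𝒮) i j hij x) = st.tLin 𝒮 i j hij x ∧
      ψ (stp.fLin (exchange 𝒮) i j hij x) = st.fLin 𝒮 i j hij x ∧
      ψ (stp.gLin (exchange 𝒮) i j hij x) = st.gLin 𝒮 i j hij x := by
  refine stp.exists_hom (exchange 𝒮) (st 𝒮 m m) (st.tLin 𝒮) (st.fLin 𝒮) (st.gLin 𝒮)
    (fun _ _ hij _ _ => st.tLin_mem hij) (fun _ _ hij _ _ => st.fLin_mem hij)
    (fun _ _ hij _ _ => st.gLin_mem hij) (fun i j hij x => ?_) (fun i j hij x => ?_)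
    (fun _ _ _ hij hjl hil _ _ _ hx _ hy => st.bracket_tLin_tLin hx hy hij hjl hil)
    (fun _ _ _ hij hjl hil _ _ _ hx _ hy => st.bracket_tLin_fLin hx hy hij hjl hil)
    (fun _ _ _ hij hjl hil _ _ _ hx _ hy => st.bracket_gLin_tLin hx hy hij hjl hil)
    (fun _ _ _ hij hjl hil _ _ _ hx _ hy => st.bracket_fLin_gLin hx hy hij hjl hil)
    (fun i j l r hij hjl hlr hri p q x _ y _ => ?_)
    (fun i j l r hij hjl hlr hrj p q x _ y _ => ?_)
    (fun i j l r hij hlj hlr hil p q x _ y _ => ?_)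
    (fun i j l r hij hlr p q x _ y _ => ?_)
    (fun i j l r hij hlr p q x _ y _ => ?_)
    (fun i j l r hij hil hir hjl hjr hlr p q x _ y _ => ?_)
  all_goals
    obtain ⟨a, b⟩ := x
    obtain ⟨b, rfl⟩ := (toOp 𝒮).surjective b
  -- The exchange swaps the two summands of the image, and `ρ` being an involution removes the
  -- second sign.
  · rw [rho_prod, st.fLin_apply, rho_rho, add_comm]
    rfl
  · rw [rho_prod, st.gLin_apply, rho_rho, neg_sub]
    rfl
  all_goals
    obtain ⟨c, d⟩ := y
    obtain ⟨d, rfl⟩ := (toOp 𝒮).surjective d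
    simp only [st.tLin_apply, st.fLin_apply, st.gLin_apply, map_sub, map_add,
      LinearMap.sub_apply, LinearMap.add_apply]
  -- In each remaining relation no two of the elementary terms share an inner index in either order:
  -- the indices either differ by hypothesis or lie in different halves of the index set.
  · simp [st.bracket_eLin_zero, hjl, hri, hjl.symm, hri.symm]
  · simp [st.bracket_eLin_zero, hjl, hrj, hjl.symm, hrj.symm]
  · simp [st.bracket_eLin_zero, hlj, hil, hlj.symm, hil.symm]
  · simp [st.bracket_eLin_zero]
  · simp [st.bracket_eLin_zero]
  · simp [st.bracket_eLin_zero, hil, hir, hjl, hjr, hil.symm, hir.symm, hjl.symm, hjr.symm]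

end ToSt

end Steinberg

end

/-! ### The isomorphism and its formulas on generators -/

theorem mainTheorem11 {k : Type*} [CommRing k] (h2 : IsUnit (2 : k))
    {S : Type*} [Ring S] [Algebra k S] (𝒮 : ZMod 2 → Submodule k S) [GradedAlgebra 𝒮]
    (m : ℕ) (hm : 3 ≤ m) :
    ∃ (φ : (Steinberg.st 𝒮 m m).Hom (Steinberg.stp (Steinberg.exchange 𝒮) m))
      (ψ : (Steinberg.stp (Steinberg.exchange 𝒮) m).Hom (Steinberg.st 𝒮 m m)),
      (∀ x, ψ (φ x) = x) ∧ (∀ y, φ (ψ y) = y) ∧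
      (∀ (i j : Fin m) (hij : i ≠ j) (a : S),
        φ (Steinberg.st.e 𝒮 (.inl i) (.inl j) (Sum.inl_injective.ne hij) a) =
          Steinberg.stp.t (Steinberg.exchange 𝒮) i j hij (a, 0) ∧
        φ (Steinberg.st.e 𝒮 (.inl i) (.inr j) Sum.inl_ne_inr a) =
          Steinberg.stp.f (Steinberg.exchange 𝒮) i j hij (a, 0) ∧
        φ (Steinberg.st.e 𝒮 (.inr i) (.inl j) Sum.inr_ne_inl a) =
          Steinberg.stp.g (Steinberg.exchange 𝒮) i j hij (a, 0) ∧
        φ (Steinberg.st.e 𝒮 (.inr i) (.inr j) (Sum.inr_injective.ne hij) a) =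
          -Steinberg.stp.t (Steinberg.exchange 𝒮) j i hij.symm (0, Steinberg.toOp 𝒮 a) ∧
        φ (Steinberg.st.e 𝒮 (.inl i) (.inr i) Sum.inl_ne_inr a) =
          (Steinberg.stp (Steinberg.exchange 𝒮) m).bracket
            (Steinberg.stp.t (Steinberg.exchange 𝒮) i j hij (1, 0))
            (Steinberg.stp.f (Steinberg.exchange 𝒮) j i hij.symm (a, 0)) ∧
        φ (Steinberg.st.e 𝒮 (.inr i) (.inl i) Sum.inr_ne_inl a) =
          (Steinberg.stp (Steinberg.exchange 𝒮) m).bracket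
            (Steinberg.stp.g (Steinberg.exchange 𝒮) i j hij (a, 0))
            (Steinberg.stp.t (Steinberg.exchange 𝒮) j i hij.symm (1, 0))) ∧
      (∀ (i j : Fin m) (hij : i ≠ j) (a b : S),
        ψ (Steinberg.stp.t (Steinberg.exchange 𝒮) i j hij (a, Steinberg.toOp 𝒮 b)) =
          Steinberg.st.e 𝒮 (.inl i) (.inl j) (Sum.inl_injective.ne hij) a -
            Steinberg.st.e 𝒮 (.inr j) (.inr i) (Sum.inr_injective.ne hij.symm) b ∧
        ψ (Steinberg.stp.f (Steinberg.exchange 𝒮) i j hij (a, Steinberg.toOp 𝒮 b)) =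
          Steinberg.st.e 𝒮 (.inl i) (.inr j) Sum.inl_ne_inr a +
            Steinberg.st.e 𝒮 (.inl j) (.inr i) Sum.inl_ne_inr (Steinberg.rho 𝒮 b) ∧
        ψ (Steinberg.stp.g (Steinberg.exchange 𝒮) i j hij (a, Steinberg.toOp 𝒮 b)) =
          Steinberg.st.e 𝒮 (.inr i) (.inl j) Sum.inr_ne_inl a -
            Steinberg.st.e 𝒮 (.inr j) (.inl i) Sum.inr_ne_inl (Steinberg.rho 𝒮 b)) := by
  open Steinberg in
  obtain ⟨φ, hφ, hφ'⟩ := (stp.isRootFamily_root 𝒮 hm).exists_hom hm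
  obtain ⟨ψ, hψ⟩ := exists_hom_stp_st 𝒮 m
  have hT := fun i j hij a b => (hψ i j hij (a, toOp 𝒮 b)).1
  have hF := fun i j hij a b => (hψ i j hij (a, toOp 𝒮 b)).2.1
  have hG := fun i j hij a b => (hψ i j hij (a, toOp 𝒮 b)).2.2
  have hll : ∀ (i j : Fin m) (hij : i ≠ j) (a : S),
      φ (st.eLin 𝒮 (.inl i) (.inl j) (Sum.inl_injective.ne hij) a) =
        stp.tLin (exchange 𝒮) i j hij (a, 0) := fun i j hij a =>
    (hφ (.inl i) (.inl j) _ a hij).trans (stp.root_inl_inl hij a)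
  have hlr : ∀ (i j : Fin m) (hij : i ≠ j) (a : S),
      φ (st.eLin 𝒮 (.inl i) (.inr j) Sum.inl_ne_inr a) =
        stp.fLin (exchange 𝒮) i j hij (a, 0) := fun i j hij a =>
    (hφ (.inl i) (.inr j) _ a hij).trans (stp.root_inl_inr hij a)
  have hrl : ∀ (i j : Fin m) (hij : i ≠ j) (a : S),
      φ (st.eLin 𝒮 (.inr i) (.inl j) Sum.inr_ne_inl a) =
        stp.gLin (exchange 𝒮) i j hij (a, 0) := fun i j hij a =>
    (hφ (.inr i) (.inl j) _ a hij).trans (stp.root_inr_inl hij a)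
  have hrr : ∀ (i j : Fin m) (hij : i ≠ j) (a : S),
      φ (st.eLin 𝒮 (.inr i) (.inr j) (Sum.inr_injective.ne hij) a) =
        -stp.tLin (exchange 𝒮) j i hij.symm (0, toOp 𝒮 a) := fun i j hij a =>
    (hφ (.inr i) (.inr j) _ a hij).trans (stp.root_inr_inr hij a)
  have hlr' : ∀ (i j : Fin m) (hij : i ≠ j) (a : S),
      φ (st.eLin 𝒮 (.inl i) (.inr i) Sum.inl_ne_inr a) = (stp (exchange 𝒮) m).bracket
        (stp.tLin (exchange 𝒮) i j hij (1, 0)) (stp.fLin (exchange 𝒮) j i hij.symm (a, 0)) :=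
    fun i j hij a => by
      -- The factorization `1 * a` and the auxiliary index `j` are free, so the prescribed formula
      -- holds for every `j ≠ i`.
      have h := hφ' (.inl i) (.inr i) (.inl j) Sum.inl_ne_inr 1 a rfl hij
      rwa [one_mul, stp.root_inl_inl hij, stp.root_inl_inr hij.symm] at h
  have hrl' : ∀ (i j : Fin m) (hij : i ≠ j) (a : S),
      φ (st.eLin 𝒮 (.inr i) (.inl i) Sum.inr_ne_inl a) = (stp (exchange 𝒮) m).bracket
        (stp.gLin (exchange 𝒮) i j hij (a, 0)) (stp.tLin (exchange 𝒮) j i hij.symm (1, 0)) :=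
    fun i j hij a => by
      have h := hφ' (.inr i) (.inl i) (.inl j) Sum.inr_ne_inl a 1 rfl hij
      rwa [mul_one, stp.root_inr_inl hij, stp.root_inl_inl hij.symm] at h
  have hT0 : ∀ i j hij a, ψ (stp.tLin (exchange 𝒮) i j hij (a, 0)) =
      st.eLin 𝒮 (.inl i) (.inl j) (Sum.inl_injective.ne hij) a := fun i j hij a => by
    -- The argument `(a, 0)` is the case `b = 0`, where the second term of the image disappears.
    have h := hT i j hij a 0
    rwa [st.tLin_apply, map_zero, map_zero, sub_zero] at h
  have hT1 : ∀ i j hij b, ψ (stp.tLin (exchange 𝒮) i j hij (0, toOp 𝒮 b)) =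
      -st.eLin 𝒮 (.inr j) (.inr i) (Sum.inr_injective.ne hij.symm) b := fun i j hij b => by
    rw [hT i j hij 0 b, st.tLin_apply, map_zero, zero_sub]
  have hF0 : ∀ i j hij a, ψ (stp.fLin (exchange 𝒮) i j hij (a, 0)) =
      st.eLin 𝒮 (.inl i) (.inr j) Sum.inl_ne_inr a := fun i j hij a => by
    have h := hF i j hij a 0
    rwa [st.fLin_apply, map_zero, map_zero, map_zero, add_zero] at h
  have hG0 : ∀ i j hij a, ψ (stp.gLin (exchange 𝒮) i j hij (a, 0)) =
      st.eLin 𝒮 (.inr i) (.inl j) Sum.inr_ne_inl a := fun i j hij a => by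
    have h := hG i j hij a 0
    rwa [st.gLin_apply, map_zero, map_zero, map_zero, sub_zero] at h
  refine ⟨φ, ψ, ?_, ?_, fun i j hij a => ⟨hll i j hij a, hlr i j hij a, hrl i j hij a,
    hrr i j hij a, hlr' i j hij a, hrl' i j hij a⟩,
    fun i j hij a b => ⟨hT i j hij a b, hF i j hij a b, hG i j hij a b⟩⟩
  · have key : ∀ x y hxy a, ψ (φ (st.eLin 𝒮 x y hxy a)) = st.eLin 𝒮 x y hxy a := by
      intro x y hxy a
      by_cases h : baseIndex x = baseIndex y
      · rcases x with i | i <;> obtain rfl := eq_swap h hxy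
        -- Any `j ≠ i` will do: the image is a bracket through `j`, and mapping it back gives a
        -- product in `st` that recovers `e_{i,m+i}(a)`.
        · obtain ⟨j, hj, -⟩ := exists_fin_ne_ne hm i i
          refine (congrArg ψ.toLinearMap (hlr' i j hj.symm a)).trans ?_
          rw [ψ.map_bracket, hT0, hF0, st.bracket_eLin _ _ _ Sum.inl_ne_inr, one_mul]
          rfl
        · obtain ⟨j, hj, -⟩ := exists_fin_ne_ne hm i i
          refine (congrArg ψ.toLinearMap (hrl' i j hj.symm a)).trans ?_
          rw [ψ.map_bracket, hG0, hT0, st.bracket_eLin _ _ _ Sum.inr_ne_inl, mul_one]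
          rfl
      · rcases x with i | i <;> rcases y with j | j <;>
          simp only [baseIndex_inl, baseIndex_inr] at h
        · rw [hll i j h, hT0]
        · rw [hlr i j h, hF0]
        · rw [hrl i j h, hG0]
        · rw [hrr i j h, map_neg, hT1, neg_neg]
    refine presented.eq_self_of_gen (stRel_homogeneous 𝒮 m m) (ψ.toLinearMap ∘ₗ φ.toLinearMap)
      (fun x y => ?_) fun
      | .e x y hxy p a => ?_
    · exact (congrArg ψ.toLinearMap (φ.map_bracket x y)).trans (ψ.map_bracket _ _)
    · have h := key x y hxy a
      rw [st.eLin_of_mem x y hxy a.2] at h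
      exact h
  -- The values of `φ` are known on each summand separately, so arguments are split. For `f` and `g`
  -- the `S^op` part is first transposed into `S`.
  · have split : ∀ x : S × SuperOp 𝒮, ∃ a b, x = (a, 0) + (0, toOp 𝒮 b) := fun x =>
      ⟨x.1, (toOp 𝒮).symm x.2, by simp⟩
    have keyT : ∀ i j hij x, φ (ψ (stp.tLin (exchange 𝒮) i j hij x)) =
        stp.tLin (exchange 𝒮) i j hij x := by
      intro i j hij x
      obtain ⟨a, b, rfl⟩ := split x
      rw [map_add, map_add, map_add, hT0, hT1, map_neg, hll, hrr _ _ hij.symm, neg_neg]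
    have keyF : ∀ i j hij x, φ (ψ (stp.fLin (exchange 𝒮) i j hij x)) =
        stp.fLin (exchange 𝒮) i j hij x := by
      intro i j hij x
      obtain ⟨a, b, rfl⟩ := split x
      rw [map_add, map_add, map_add, hF0, stp.fLin_inr, hF0, hlr _ _ hij, hlr _ _ hij.symm]
    have keyG : ∀ i j hij x, φ (ψ (stp.gLin (exchange 𝒮) i j hij x)) =
        stp.gLin (exchange 𝒮) i j hij x := by
      intro i j hij x
      obtain ⟨a, b, rfl⟩ := split x
      rw [map_add, map_add, map_add, hG0, stp.gLin_inr, map_neg, map_neg, hG0, hrl _ _ hij,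
        hrl _ _ hij.symm]
    refine presented.eq_self_of_gen (stpRel_homogeneous (exchange 𝒮) m)
      (φ.toLinearMap ∘ₗ ψ.toLinearMap) (fun x y => ?_) fun
      | .t i j hij p a => ?_
      | .f i j hij p a => ?_
      | .g i j hij p a => ?_
    · exact (congrArg φ.toLinearMap (ψ.map_bracket x y)).trans (φ.map_bracket _ _)
    · have h := keyT i j hij a
      rw [stp.tLin_of_mem _ i j hij a.2] at h
      exact h
    · have h := keyF i j hij a
      rw [stp.fLin_of_mem _ i j hij a.2] at h
      exact h
    · have h := keyG i j hij a
      rw [stp.gLin_of_mem _ i j hij a.2] at h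
      exact h
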